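/- **Theorem 5.3.** Let $E=(E^0,E^1,r,s)$ be a finite directed graph without sinks (every vertex emits at least one edge), and let $C^*(E)$ be its graph $C^*$-algebra, i.e. the universal $C^*$-algebra generated by mutually orthogonal projections $P_v$ ($v\in E^0$) and partial isometries $S_e$ ($e\in E^1$) with $S_e^*S_e=P_{r(e)}$, $S_e^*S_f=0$ for $e\ne f$, $S_eS_e^*\le P_{s(e)}$, and $P_v=\sum_{s(e)=v}S_eS_e^*$ for every $v\in E^0$. It is unital with $1=\sum_v P_v$. For a path $\mu=(\mu_1,\dots,\mu_k)$ (where $r(\mu_j)=s(\mu_{j+1})$; vertices are the paths of length $0$) put $S_\mu=S_{\mu_1}\cdots S_{\mu_k}$ (and $S_v=P_v$), $P_\mu=S_\mu S_\mu^*$, and let $E^k$ be the set of paths of length $k$. Let $$\mathcal D_E^k=\operatorname{span}\{P_\mu:\mu\in E^k\},\qquad \mathcal F_E^k=\operatorname{span}\{S_\mu S_\nu^*:\mu,\nu\in E^k\},$$ and let $\mathcal D_E$ be the $C^*$-subalgebra of $C^*(E)$ generated by all $P_\mu$, $\mu$ a finite path. Let $\mathcal U_E$ be the set of unitaries of $C^*(E)$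 that commute with all $P_v$, $v\in E^0$. For $u\in\mathcal U_E$ let $\lambda_u$ be the $*$-endomorphism of $C^*(E)$ with $\lambda_u(S_e)=uS_e$ for $e\in E^1$ and $\lambda_u(P_v)=P_v$ for $v\in E^0$. Let $k\ge1$ and let $u\in\mathcal U_E$ be such that $u\in\mathcal F_E^k$ and $u\mathcal D_E^ku^*=\mathcal D_E^k$. For $e,f\in E^1$ the linear map $x\mapsto S_e^*u^*xuS_f$ leaves $\mathcal D_E^{k-1}$ and its subspace $\mathcal D_E^0$ invariant; let $b^u_{e,f}$ be its restriction to $\mathcal D_E^{k-1}$ and let $\tilde b^u_{e,f}$ be the linear map that $b^u_{e,f}$ induces on $V_k^D=\mathcal D_E^{k-1}/\mathcal D_E^0$. Let $A_u^D$ be the (not necessarily unital) subring of the ring of linear maps $V_k^D\to V_k^D$ generated by $\{\tilde b^u_{e,f}:e,f\in E^1\}$. Let $H=\operatorname{span}\{S_e:e\in E^1\}$, let $\Xi_0^D=\mathcal D_E^{k-1}$, for $r\ge1$ let $\Xi_r^D$ be the linear span of $\lambda_u(H)^*\,\Xi_{r-1}^D\,\lambda_u(H)$, and let $\Xi_u^D=\bigcap_{r\ge0}\Xi_r^D$.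 Then the following conditions are equivalent: 1. $\lambda_u$ restricts to an automorphism of $\mathcal D_E$ (it maps $\mathcal D_E$ bijectively onto itself); 2. the ring $A_u^D$ is nilpotent, i.e. $(A_u^D)^l=\{0\}$ for some $l\ge1$; 3. $\Xi_u^D\subseteq\mathcal D_E^0$. -/

import Mathlib

universe u v w

/-- A directed graph `E = (E⁰, E¹, r, s)` with vertex set `V` and edge set `Ed`. -/
structure DirectedGraph (V : Type u) (Ed : Type v) where
  /-- the range map -/
  r : Ed → V
  /-- the source map -/
  s : Ed → V

namespace DirectedGraph

open scoped ENNReal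

variable {V : Type u} {Ed : Type v} (E : DirectedGraph V Ed)

/-- A sink is a vertex that emits no edge. -/
def NoSinks : Prop := ∀ v : V, ∃ e : Ed, E.s e = v

/-! ### Cuntz-Krieger families and the universal C⋆-algebra -/

/-- `(P, S)` is a Cuntz-Krieger `E`-family in the C⋆-algebra `B`: mutually orthogonal projections
`P v` and partial isometries `S e` satisfying the graph relations. For projections `p` and `q`,
the relation `p ≤ q` is expressed as `q * p = p`. -/
structure IsCKFamily {B : Type w} [NonUnitalCStarAlgebra B] (P : V → B) (S : Ed → B) :
    Prop where
  isStarProjection : ∀ v, IsStarProjection (P v)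
  orthogonal : ∀ v w, v ≠ w → P v * P w = 0
  partialIsometry : ∀ e, S e * star (S e) * S e = S e
  star_mul_self : ∀ e, star (S e) * S e = P (E.r e)
  star_mul_of_ne : ∀ e f, e ≠ f → star (S e) * S f = 0
  range_le : ∀ e, P (E.s e) * (S e * star (S e)) = S e * star (S e)
  sum_range : ∀ (v : V) (h : {e | E.s e = v}.Finite), {e | E.s e = v}.Nonempty →
    P v = ∑ e ∈ h.toFinset, S e * star (S e)

/-- A Cuntz-Krieger `E`-family together with the C⋆-algebra that contains it. The carriers range
over a universe that contains, up to isomorphism, every C⋆-algebra generated by a Cuntz-Krieger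
`E`-family, see `exists_small_model`. -/
structure CKRep where
  carrier : Type (max u v)
  [cstar : NonUnitalCStarAlgebra carrier]
  P : V → carrier
  S : Ed → carrier
  isCK : E.IsCKFamily P S

attribute [instance] CKRep.cstar

variable {E}

theorem IsCKFamily.norm_P_le {B : Type w} [NonUnitalCStarAlgebra B] {P : V → B} {S : Ed → B}
    (h : E.IsCKFamily P S) (v : V) : ‖P v‖ ≤ 1 := by
  have h1 : ‖P v‖ = ‖P v‖ * ‖P v‖ := by
    have := CStarRing.norm_star_mul_self (x := P v)
    rwa [(h.isStarProjection v).isSelfAdjoint.star_eq,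
      (h.isStarProjection v).isIdempotentElem.eq] at this
  nlinarith [norm_nonneg (P v)]

theorem IsCKFamily.norm_S_le {B : Type w} [NonUnitalCStarAlgebra B] {P : V → B} {S : Ed → B}
    (h : E.IsCKFamily P S) (e : Ed) : ‖S e‖ ≤ 1 := by
  have h1 := CStarRing.norm_star_mul_self (x := S e)
  rw [h.star_mul_self] at h1
  nlinarith [norm_nonneg (S e), h.norm_P_le (E.r e)]

/-- Cuntz-Krieger families are mapped to such families by `*`-homomorphisms. -/
theorem IsCKFamily.map {B : Type w} [NonUnitalCStarAlgebra B] {C : Type*}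
    [NonUnitalCStarAlgebra C] {P : V → B} {S : Ed → B} (h : E.IsCKFamily P S)
    (φ : B →⋆ₙₐ[ℂ] C) : E.IsCKFamily (fun v => φ (P v)) (fun e => φ (S e)) where
  isStarProjection v := (h.isStarProjection v).map φ
  orthogonal v w hvw := by rw [← map_mul, h.orthogonal v w hvw, map_zero]
  partialIsometry e := by rw [← map_star, ← map_mul, ← map_mul, h.partialIsometry]
  star_mul_self e := by rw [← map_star, ← map_mul, h.star_mul_self]
  star_mul_of_ne e f hef := by rw [← map_star, ← map_mul, h.star_mul_of_ne e f hef, map_zero]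
  range_le e := by rw [← map_star, ← map_mul, ← map_mul, h.range_le]
  sum_range v hf hn := by
    rw [h.sum_range v hf hn, map_sum]
    exact Finset.sum_congr rfl fun e _ => by rw [map_mul, map_star]

/-- If an injective `*`-homomorphism maps `(P, S)` to a Cuntz-Krieger family then `(P, S)` is
one. -/
theorem IsCKFamily.of_map {B : Type w} [NonUnitalCStarAlgebra B] {C : Type*}
    [NonUnitalCStarAlgebra C] {P : V → B} {S : Ed → B}
    (φ : B →⋆ₙₐ[ℂ] C) (hφ : Function.Injective φ)
    (h : E.IsCKFamily (fun v => φ (P v)) (fun e => φ (S e))) : E.IsCKFamily P S where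
  isStarProjection v :=
    ⟨hφ (by simpa using (h.isStarProjection v).isIdempotentElem.eq),
      hφ (by simpa [map_star] using (h.isStarProjection v).isSelfAdjoint.star_eq)⟩
  orthogonal v w hvw := hφ (by simpa using h.orthogonal v w hvw)
  partialIsometry e := hφ (by simpa [map_star] using h.partialIsometry e)
  star_mul_self e := hφ (by simpa [map_star] using h.star_mul_self e)
  star_mul_of_ne e f hef := hφ (by simpa [map_star] using h.star_mul_of_ne e f hef)
  range_le e := hφ (by simpa [map_star] using h.range_le e)
  sum_range v hf hn := hφ (by simpa [map_star, map_sum] using h.sum_range v hf hn)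

variable (E)

/-- The family of all `P v`, over all Cuntz-Krieger `E`-families. -/
noncomputable def prodP (v : V) : lp (fun R : CKRep E => R.carrier) ∞ :=
  ⟨fun R => R.P v, memℓp_infty ⟨1, by rintro _ ⟨R, rfl⟩; exact R.isCK.norm_P_le v⟩⟩

/-- The family of all `S e`, over all Cuntz-Krieger `E`-families. -/
noncomputable def prodS (e : Ed) : lp (fun R : CKRep E => R.carrier) ∞ :=
  ⟨fun R => R.S e, memℓp_infty ⟨1, by rintro _ ⟨R, rfl⟩; exact R.isCK.norm_S_le e⟩⟩

/-- The C⋆-subalgebra of the product of all `CKRep E` that is generated by the universal family. -/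
noncomputable def graphSubalgebra :
    NonUnitalStarSubalgebra ℂ (lp (fun R : CKRep E => R.carrier) ∞) :=
  (NonUnitalStarAlgebra.adjoin ℂ
    (Set.range E.prodP ∪ Set.range E.prodS)).topologicalClosure

/-- The graph C⋆-algebra `C*(E)`: the universal C⋆-algebra generated by a Cuntz-Krieger
`E`-family, see `existsUnique_lift`. -/
def CStar : Type (max u v + 1) := E.graphSubalgebra

/-- The C⋆-algebra structure of `C*(E)`, inherited from the product. -/
noncomputable def cstarStructure : NonUnitalCStarAlgebra E.CStar :=
  NonUnitalStarSubalgebra.nonUnitalCStarAlgebra E.graphSubalgebra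
    (h_closed := NonUnitalStarSubalgebra.isClosed_topologicalClosure _)

noncomputable instance instNonUnitalCStarAlgebraCStar : NonUnitalCStarAlgebra E.CStar :=
  cstarStructure E

/-- Elements of the dense `*`-subalgebra, as elements of `C*(E)`. -/
def ofAdjoin (x : lp (fun R : CKRep E => R.carrier) ∞)
    (hx : x ∈ NonUnitalStarAlgebra.adjoin ℂ (Set.range E.prodP ∪ Set.range E.prodS)) : E.CStar :=
  ⟨x, NonUnitalStarSubalgebra.le_topologicalClosure _ hx⟩

/-- The vertex projection `P_v` of `C*(E)`. -/
noncomputable def P (v : V) : E.CStar :=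
  E.ofAdjoin (E.prodP v) (NonUnitalStarAlgebra.subset_adjoin ℂ _ (Or.inl ⟨v, rfl⟩))

/-- The partial isometry `S_e` of `C*(E)`. -/
noncomputable def S (e : Ed) : E.CStar :=
  E.ofAdjoin (E.prodS e) (NonUnitalStarAlgebra.subset_adjoin ℂ _ (Or.inr ⟨e, rfl⟩))

/-- The inclusion of `C*(E)` into the product. -/
noncomputable def incl : E.CStar →⋆ₙₐ[ℂ] lp (fun R : CKRep E => R.carrier) ∞ :=
  NonUnitalStarSubalgebraClass.subtype E.graphSubalgebra

/-- Evaluation of the product at a family. -/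
noncomputable def evalLp (R : CKRep E) :
    lp (fun R : CKRep E => R.carrier) ∞ →⋆ₙₐ[ℂ] R.carrier where
  toFun x := x R
  map_smul' _ _ := rfl
  map_zero' := rfl
  map_add' _ _ := rfl
  map_mul' _ _ := rfl
  map_star' _ := rfl

theorem incl_injective : Function.Injective E.incl := Subtype.val_injective

theorem isCKFamily_prod : E.IsCKFamily E.prodP E.prodS where
  isStarProjection v :=
    ⟨Subtype.ext <| funext fun R => (R.isCK.isStarProjection v).isIdempotentElem.eq,
      Subtype.ext <| funext fun R => (R.isCK.isStarProjection v).isSelfAdjoint.star_eq⟩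
  orthogonal v w hvw := Subtype.ext <| funext fun R => R.isCK.orthogonal v w hvw
  partialIsometry e := Subtype.ext <| funext fun R => R.isCK.partialIsometry e
  star_mul_self e := Subtype.ext <| funext fun R => R.isCK.star_mul_self e
  star_mul_of_ne e f hef := Subtype.ext <| funext fun R => R.isCK.star_mul_of_ne e f hef
  range_le e := Subtype.ext <| funext fun R => R.isCK.range_le e
  sum_range v hf hn := Subtype.ext <| funext fun R => by
    change R.P v = E.evalLp R _
    rw [map_sum]
    exact R.isCK.sum_range v hf hn

theorem isCKFamily_PS : E.IsCKFamily E.P E.S :=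
  IsCKFamily.of_map E.incl E.incl_injective E.isCKFamily_prod

variable {E} in
/-- A closed property that holds for the generators and is preserved by the algebraic operations
holds on all of `C*(E)`. -/
theorem CStar.induction {p : E.CStar → Prop} (hP : ∀ v, p (E.P v)) (hS : ∀ e, p (E.S e))
    (zero : p 0) (add : ∀ x y, p x → p y → p (x + y)) (mul : ∀ x y, p x → p y → p (x * y))
    (smul : ∀ (c : ℂ) (x), p x → p (c • x)) (star : ∀ x, p x → p (star x))
    (closed : IsClosed {x | p x}) (x : E.CStar) : p x := by
  have key : ∀ (x) (hx : x ∈ NonUnitalStarAlgebra.adjoin ℂ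
      (Set.range E.prodP ∪ Set.range E.prodS)), p (E.ofAdjoin x hx) := by
    intro x hx
    induction hx using NonUnitalStarAlgebra.adjoin_induction with
    | mem x hx =>
      rcases hx with ⟨v, rfl⟩ | ⟨e, rfl⟩
      · exact hP v
      · exact hS e
    | add x y hx hy h1 h2 => exact add (E.ofAdjoin x hx) (E.ofAdjoin y hy) h1 h2
    | zero => exact zero
    | mul x y hx hy h1 h2 => exact mul (E.ofAdjoin x hx) (E.ofAdjoin y hy) h1 h2
    | smul c x hx h => exact smul c (E.ofAdjoin x hx) h
    | star x hx h => exact star (E.ofAdjoin x hx) h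
  obtain ⟨x, hx⟩ := x
  obtain ⟨y, hy, hlim⟩ := mem_closure_iff_seq_limit.1 (show x ∈ closure _ from hx)
  have hl : Filter.Tendsto (fun n => E.ofAdjoin (y n) (hy n)) Filter.atTop (nhds ⟨x, hx⟩) :=
    tendsto_subtype_rng.2 hlim
  exact closed.mem_of_tendsto hl (Filter.Eventually.of_forall fun n => key _ (hy n))

/-- `*`-homomorphisms on `C*(E)` are determined by their values on the generators. -/
theorem hom_ext {B : Type w} [NonUnitalCStarAlgebra B] {φ ψ : E.CStar →⋆ₙₐ[ℂ] B}
    (hP : ∀ v, φ (E.P v) = ψ (E.P v)) (hS : ∀ e, φ (E.S e) = ψ (E.S e)) : φ = ψ := by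
  have hcφ : Continuous φ := AddMonoidHomClass.continuous_of_bound φ 1 fun x => by
    simpa using NonUnitalStarAlgHom.norm_apply_le φ x
  have hcψ : Continuous ψ := AddMonoidHomClass.continuous_of_bound ψ 1 fun x => by
    simpa using NonUnitalStarAlgHom.norm_apply_le ψ x
  refine DFunLike.ext _ _ (CStar.induction hP hS (by simp) ?_ ?_ ?_ ?_ (isClosed_eq hcφ hcψ))
  · intro x y hx hy
    rw [map_add, map_add, hx, hy]
  · intro x y hx hy
    rw [map_mul, map_mul, hx, hy]
  · intro c x hx
    rw [map_smul, map_smul, hx]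
  · intro x hx
    rw [map_star, map_star, hx]

/-- Formal `*`-polynomials in the generators. -/
inductive StarPoly (V : Type u) (Ed : Type v) : Type (max u v)
  | P (v : V) : StarPoly V Ed
  | S (e : Ed) : StarPoly V Ed
  | zero : StarPoly V Ed
  | add (x y : StarPoly V Ed) : StarPoly V Ed
  | mul (x y : StarPoly V Ed) : StarPoly V Ed
  | smul (c : ℂ) (x : StarPoly V Ed) : StarPoly V Ed
  | star (x : StarPoly V Ed) : StarPoly V Ed

/-- Evaluation of a formal `*`-polynomial. -/
def StarPoly.eval {B : Type w} [NonUnitalCStarAlgebra B] (P : V → B) (S : Ed → B) : StarPoly V Ed → B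
  | .P v => P v
  | .S e => S e
  | .zero => 0
  | .add x y => x.eval P S + y.eval P S
  | .mul x y => x.eval P S * y.eval P S
  | .smul c x => c • x.eval P S
  | .star x => Star.star (x.eval P S)

/-- Transport of a C⋆-algebra structure along a bijection. -/
theorem exists_transport {A : Type w} [NonUnitalCStarAlgebra A] {X : Type*} (eq : X ≃ A) :
    ∃ (_ : NonUnitalCStarAlgebra X) (φ : X →⋆ₙₐ[ℂ] A), ∀ x, φ x = eq x := by
  let i1 : NonUnitalRing X := eq.nonUnitalRing
  let i2 : Module ℂ X := eq.module ℂ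
  have hmul : ∀ x y : X, eq (x * y) = eq x * eq y := fun x y => eq.apply_symm_apply _
  have hadd : ∀ x y : X, eq (x + y) = eq x + eq y := fun x y => eq.apply_symm_apply _
  have hzero : eq 0 = 0 := eq.apply_symm_apply _
  have hsmul : ∀ (c : ℂ) (x : X), eq (c • x) = c • eq x := fun c x => eq.apply_symm_apply _
  let f : X →ₙ+* A :=
    { toFun := eq
      map_mul' := hmul
      map_zero' := hzero
      map_add' := hadd }
  let fl : X →ₗ[ℂ] A :=
    { toFun := eq
      map_smul' := hsmul
      map_add' := hadd }
  let i3 : NonUnitalNormedRing X := NonUnitalNormedRing.induced X A f eq.injective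
  let i4 : NormedSpace ℂ X := NormedSpace.induced ℂ X A fl
  let i5 : StarRing X :=
    { star := fun x => eq.symm (star (eq x))
      star_involutive := fun x => by simp
      star_mul := fun x y => eq.injective (by simp [hmul])
      star_add := fun x y => eq.injective (by simp [hadd]) }
  have hstar : ∀ x : X, eq (star x) = star (eq x) := fun x => eq.apply_symm_apply _
  have hnorm : ∀ x : X, ‖x‖ = ‖eq x‖ := fun _ => rfl
  have hiso : Isometry eq := AddMonoidHomClass.isometry_of_norm f fun _ => rfl
  let i6 : CompleteSpace X :=
    ((IsometryEquiv.mk eq hiso).completeSpace_iff).2 inferInstance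
  let i7 : NonUnitalCStarAlgebra X :=
    { i3, i5, i6, i4 with
      norm_mul_self_le := fun x => by
        rw [hnorm, hnorm, hmul, hstar, CStarRing.norm_star_mul_self]
      smul_assoc := fun c x y => eq.injective (by
        simp only [smul_eq_mul, hmul, hsmul, smul_mul_assoc])
      smul_comm := fun c x y => eq.injective (by
        simp only [smul_eq_mul, hmul, hsmul, mul_smul_comm])
      star_smul := fun c x => eq.injective (by simp only [hstar, hsmul, star_smul]) }
  let φ : X →⋆ₙₐ[ℂ] A :=
    { toFun := eq
      map_smul' := hsmul
      map_zero' := hzero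
      map_add' := hadd
      map_mul' := hmul
      map_star' := hstar }
  exact ⟨i7, φ, fun _ => rfl⟩

/-- The C⋆-algebra generated by `V` and `Ed`-indexed families has a copy in `Type (max u v)`. -/
theorem exists_small_model {B : Type w} [NonUnitalCStarAlgebra B] (P : V → B) (S : Ed → B) :
    ∃ (X : Type (max u v)) (_ : NonUnitalCStarAlgebra X) (φ : X →⋆ₙₐ[ℂ] B) (P' : V → X)
      (S' : Ed → X), Function.Injective φ ∧ (∀ v, φ (P' v) = P v) ∧ ∀ e, φ (S' e) = S e := by
  let A₀ := NonUnitalStarAlgebra.adjoin ℂ (Set.range P ∪ Set.range S)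
  let A := A₀.topologicalClosure
  have hsm₀ : ∀ x ∈ A₀, ∃ t : StarPoly V Ed, t.eval P S = x := by
    intro x hx
    induction hx using NonUnitalStarAlgebra.adjoin_induction with
    | mem x hx =>
      rcases hx with ⟨v, rfl⟩ | ⟨e, rfl⟩
      · exact ⟨.P v, rfl⟩
      · exact ⟨.S e, rfl⟩
    | add x y _ _ h1 h2 =>
      obtain ⟨a, rfl⟩ := h1
      obtain ⟨b, rfl⟩ := h2
      exact ⟨.add a b, rfl⟩
    | zero => exact ⟨.zero, rfl⟩
    | mul x y _ _ h1 h2 =>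
      obtain ⟨a, rfl⟩ := h1
      obtain ⟨b, rfl⟩ := h2
      exact ⟨.mul a b, rfl⟩
    | smul c x _ h =>
      obtain ⟨a, rfl⟩ := h
      exact ⟨.smul c a, rfl⟩
    | star x _ h =>
      obtain ⟨a, rfl⟩ := h
      exact ⟨.star a, rfl⟩
  have hsm : ∀ x : A, ∃ t : ℕ → StarPoly V Ed,
      Filter.Tendsto (fun n => (t n).eval P S) Filter.atTop (nhds (x : B)) := by
    rintro ⟨x, hx⟩
    obtain ⟨y, hy, hlim⟩ := mem_closure_iff_seq_limit.1 (show x ∈ closure _ from hx)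
    choose t ht using fun n => hsm₀ (y n) (hy n)
    exact ⟨t, by simpa only [ht] using hlim⟩
  choose t ht using hsm
  have hinj : Function.Injective t := fun x y hxy =>
    Subtype.ext (tendsto_nhds_unique (ht x) (by rw [hxy]; exact ht y))
  let instA : NonUnitalCStarAlgebra A :=
    NonUnitalStarSubalgebra.nonUnitalCStarAlgebra A
      (h_closed := NonUnitalStarSubalgebra.isClosed_topologicalClosure _)
  let eq : A ≃ Set.range t := Equiv.ofInjective t hinj
  obtain ⟨i, φ, hφ⟩ := exists_transport eq.symm
  have hP : ∀ v, P v ∈ A := fun v => NonUnitalStarSubalgebra.le_topologicalClosure _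
    (NonUnitalStarAlgebra.subset_adjoin ℂ _ (Or.inl ⟨v, rfl⟩))
  have hS : ∀ e, S e ∈ A := fun e => NonUnitalStarSubalgebra.le_topologicalClosure _
    (NonUnitalStarAlgebra.subset_adjoin ℂ _ (Or.inr ⟨e, rfl⟩))
  refine ⟨Set.range t, i, (NonUnitalStarSubalgebraClass.subtype A).comp φ,
    fun v => eq ⟨P v, hP v⟩, fun e => eq ⟨S e, hS e⟩, ?_, fun v => ?_, fun e => ?_⟩
  · intro x y hxy
    have h1 : φ x = φ y := Subtype.ext hxy
    rw [hφ, hφ] at h1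
    exact eq.symm.injective h1
  · change ((φ (eq ⟨P v, hP v⟩) : A) : B) = P v
    rw [hφ, Equiv.symm_apply_apply]
  · change ((φ (eq ⟨S e, hS e⟩) : A) : B) = S e
    rw [hφ, Equiv.symm_apply_apply]

variable {E} in
/-- The universal property of `C*(E)`: every Cuntz-Krieger `E`-family in a C⋆-algebra (in any
universe) is the image of the generators under a unique `*`-homomorphism. -/
theorem existsUnique_lift {B : Type w} [NonUnitalCStarAlgebra B] {P : V → B} {S : Ed → B}
    (h : E.IsCKFamily P S) :
    ∃! φ : E.CStar →⋆ₙₐ[ℂ] B, (∀ v, φ (E.P v) = P v) ∧ ∀ e, φ (E.S e) = S e := by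
  obtain ⟨X, i, φ, P', S', hφ, hP, hS⟩ := exists_small_model P S
  have h' : E.IsCKFamily P' S' := IsCKFamily.of_map φ hφ (by simpa only [hP, hS] using h)
  refine ⟨φ.comp ((E.evalLp ⟨X, P', S', h'⟩).comp E.incl), ⟨hP, hS⟩, fun ψ hψ => ?_⟩
  exact E.hom_ext (fun v => (hψ.1 v).trans (hP v).symm) (fun e => (hψ.2 e).trans (hS e).symm)

/-! ### Finite graphs: the unit, the unitaries `𝒰_E` and the endomorphisms `λ_u` -/

theorem P_mul_self (v : V) : E.P v * E.P v = E.P v :=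
  (E.isCKFamily_PS.isStarProjection v).isIdempotentElem.eq

theorem star_P (v : V) : star (E.P v) = E.P v :=
  (E.isCKFamily_PS.isStarProjection v).isSelfAdjoint.star_eq

theorem P_mul_of_ne {v w : V} (h : v ≠ w) : E.P v * E.P w = 0 := E.isCKFamily_PS.orthogonal v w h

theorem P_mul_S (e : Ed) : E.P (E.s e) * E.S e = E.S e := by
  have h1 := E.isCKFamily_PS.partialIsometry e
  rw [← h1, ← mul_assoc, E.isCKFamily_PS.range_le]

theorem S_mul_P (e : Ed) : E.S e * E.P (E.r e) = E.S e := by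
  rw [← E.isCKFamily_PS.star_mul_self, ← mul_assoc, E.isCKFamily_PS.partialIsometry]

theorem P_mul_S_of_ne {v : V} {e : Ed} (h : v ≠ E.s e) : E.P v * E.S e = 0 := by
  rw [← E.P_mul_S, ← mul_assoc, E.P_mul_of_ne h, zero_mul]

theorem S_mul_P_of_ne {v : V} {e : Ed} (h : v ≠ E.r e) : E.S e * E.P v = 0 := by
  rw [← E.S_mul_P, mul_assoc, E.P_mul_of_ne h.symm, mul_zero]

section Unit

variable [Fintype V]

theorem sum_P_mul (x : E.CStar) : (∑ v, E.P v) * x = x ∧ x * (∑ v, E.P v) = x := by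
  refine CStar.induction (p := fun x => (∑ v, E.P v) * x = x ∧ x * (∑ v, E.P v) = x)
    (fun v => ?_) (fun e => ?_) (by simp) ?_ ?_ ?_ ?_ ?_ x
  · rw [Finset.sum_mul, Finset.mul_sum]
    exact ⟨(Finset.sum_eq_single v (fun w _ h => E.P_mul_of_ne h) (by simp)).trans
        (E.P_mul_self v),
      (Finset.sum_eq_single v (fun w _ h => E.P_mul_of_ne h.symm) (by simp)).trans
        (E.P_mul_self v)⟩
  · rw [Finset.sum_mul, Finset.mul_sum]
    exact ⟨(Finset.sum_eq_single (E.s e) (fun w _ h => E.P_mul_S_of_ne h) (by simp)).trans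
        (E.P_mul_S e),
      (Finset.sum_eq_single (E.r e) (fun w _ h => E.S_mul_P_of_ne h) (by simp)).trans
        (E.S_mul_P e)⟩
  · rintro x y ⟨h1, h2⟩ ⟨h3, h4⟩
    exact ⟨by rw [mul_add, h1, h3], by rw [add_mul, h2, h4]⟩
  · rintro x y ⟨h1, h2⟩ ⟨h3, h4⟩
    exact ⟨by rw [← mul_assoc, h1], by rw [mul_assoc, h4]⟩
  · rintro c x ⟨h1, h2⟩
    exact ⟨by rw [mul_smul_comm, h1], by rw [smul_mul_assoc, h2]⟩
  · rintro x ⟨h1, h2⟩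
    have hs : star (∑ v, E.P v) = ∑ v, E.P v := by simp [star_sum, E.star_P]
    exact ⟨by rw [← hs, ← star_mul, h2], by rw [← hs, ← star_mul, h1]⟩
  · exact (isClosed_eq (by fun_prop) continuous_id).inter (isClosed_eq (by fun_prop) continuous_id)


/-- A C⋆-algebra with a unit element is a unital C⋆-algebra. -/
noncomputable abbrev cstarAlgebraOfUnit (A : Type w) [i : NonUnitalCStarAlgebra A] (one : A)
    (h : ∀ x, one * x = x ∧ x * one = x) : CStarAlgebra A :=
  let r : Ring A :=
    { i.toNonUnitalNormedRing.toNonUnitalRing with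
      one := one
      one_mul := fun x => (h x).1
      mul_one := fun x => (h x).2 }
  { i, r with
    toAlgebra := Algebra.ofModule smul_mul_assoc mul_smul_comm
    norm_smul_le := norm_smul_le }

/-- If the graph has finitely many vertices then `C*(E)` is unital, with unit `∑ v, P_v`. -/
noncomputable instance instCStarAlgebra : CStarAlgebra E.CStar :=
  cstarAlgebraOfUnit E.CStar (∑ v, E.P v) E.sum_P_mul

theorem one_eq : (1 : E.CStar) = ∑ v, E.P v := rfl

end Unit

/-- `E.Path k v` is the set of paths of length `k` with source `v`. A path of length `0` is a
vertex, and a path of length `k + 1` with source `v` is an edge with source `v` followed by a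
path of length `k` that starts at the range of that edge. -/
inductive Path (E : DirectedGraph V Ed) : ℕ → V → Type (max u v)
  | nil (v : V) : Path E 0 v
  | cons {k : ℕ} {v : V} (e : Ed) (h : E.s e = v) (μ : Path E k (E.r e)) : Path E (k + 1) v

variable {E} in
/-- `S_μ = S_{μ₁} ⋯ S_{μₖ}`, with `S_v = P_v` for a vertex `v`. The recursion multiplies the product
of the edges by the projection of the last vertex, which changes nothing for `k ≥ 1`. -/
noncomputable def Path.S : {k : ℕ} → {v : V} → E.Path k v → E.CStar
  | _, _, .nil v => E.P v
  | _, _, .cons e _ μ => E.S e * μ.S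

/-- `D_E^k`, the linear span of the projections `P_μ = S_μ S_μ^*` with `|μ| = k`. -/
noncomputable def Dk (k : ℕ) : Submodule ℂ E.CStar :=
  Submodule.span ℂ {x | ∃ (v : V) (μ : E.Path k v), x = μ.S * star μ.S}

/-- `F_E^k`, the linear span of the elements `S_μ S_ν^*` with `|μ| = |ν| = k`. -/
noncomputable def Fk (k : ℕ) : Submodule ℂ E.CStar :=
  Submodule.span ℂ {x | ∃ (v w : V) (μ : E.Path k v) (ν : E.Path k w), x = μ.S * star ν.S}

/-- The diagonal `D_E`, the C⋆-subalgebra generated by the projections `P_μ = S_μ S_μ^*` of all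
finite paths. -/
noncomputable def diagonal : NonUnitalStarSubalgebra ℂ E.CStar :=
  (NonUnitalStarAlgebra.adjoin ℂ
    {x | ∃ (k : ℕ) (v : V) (μ : E.Path k v), x = μ.S * star μ.S}).topologicalClosure

section Finite

variable [Fintype V]

/-- `𝒰_E`, the unitaries of `C*(E)` that commute with all vertex projections. -/
def UE : Set E.CStar := {u | u ∈ unitary E.CStar ∧ ∀ v, u * E.P v = E.P v * u}

/-- `𝒩_B(A)`, the unitaries `u` of `C*(E)` that lie in `B` and satisfy `u A u^* = A`. (For
`B = F_E^k` and no sinks, `B` is a `*`-subalgebra with the same unit as `C*(E)`, so these are the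
unitaries of `B`.) -/
def normalizer (B A : Submodule ℂ E.CStar) : Set E.CStar :=
  {u | u ∈ B ∧ u ∈ unitary E.CStar ∧ (fun x => u * x * star u) '' (A : Set E.CStar) = A}

variable {E} {u : E.CStar}

/-- For `u ∈ 𝒰_E`, the elements `P_v` and `u S_e` form a Cuntz-Krieger family. -/
theorem isCKFamily_twist (hu : u ∈ E.UE) : E.IsCKFamily E.P (fun e => u * E.S e) where
  isStarProjection := E.isCKFamily_PS.isStarProjection
  orthogonal := E.isCKFamily_PS.orthogonal
  partialIsometry e := by
    have h1 : u * E.S e * star (u * E.S e) * (u * E.S e) =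
        u * (E.S e * (star (E.S e) * ((star u * u) * E.S e))) := by
      simp only [star_mul, mul_assoc]
    rw [h1, Unitary.star_mul_self_of_mem hu.1, one_mul, ← mul_assoc (E.S e),
      E.isCKFamily_PS.partialIsometry]
  star_mul_self e := by
    have h1 : star (u * E.S e) * (u * E.S e) = star (E.S e) * ((star u * u) * E.S e) := by
      simp only [star_mul, mul_assoc]
    rw [h1, Unitary.star_mul_self_of_mem hu.1, one_mul, E.isCKFamily_PS.star_mul_self]
  star_mul_of_ne e f hef := by
    have h1 : star (u * E.S e) * (u * E.S f) = star (E.S e) * ((star u * u) * E.S f) := by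
      simp only [star_mul, mul_assoc]
    rw [h1, Unitary.star_mul_self_of_mem hu.1, one_mul, E.isCKFamily_PS.star_mul_of_ne e f hef]
  range_le e := by
    rw [← mul_assoc, ← mul_assoc, ← hu.2, mul_assoc u, E.P_mul_S]
  sum_range v hf hn := by
    have h1 : E.P v = u * E.P v * star u := by
      rw [hu.2, mul_assoc, Unitary.mul_star_self_of_mem hu.1, mul_one]
    rw [h1, E.isCKFamily_PS.sum_range v hf hn, Finset.mul_sum, Finset.sum_mul]
    simp only [star_mul, mul_assoc]

/-- The endomorphism `λ_u` of `C*(E)`, for `u ∈ 𝒰_E`: the `*`-homomorphism with `S_e ↦ u S_e` and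
`P_v ↦ P_v`. -/
noncomputable def lam (hu : u ∈ E.UE) : E.CStar →⋆ₙₐ[ℂ] E.CStar :=
  (existsUnique_lift (isCKFamily_twist hu)).choose

theorem lam_P (hu : u ∈ E.UE) (v : V) : lam hu (E.P v) = E.P v :=
  (existsUnique_lift (isCKFamily_twist hu)).choose_spec.1.1 v

theorem lam_S (hu : u ∈ E.UE) (e : Ed) : lam hu (E.S e) = u * E.S e :=
  (existsUnique_lift (isCKFamily_twist hu)).choose_spec.1.2 e

/-! ### The maps `b^u_{e,f}` and the ring `A_u^D` -/

/-- The linear map `a^u_{e,f} : x ↦ S_e^* u^* x u S_f`. -/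
noncomputable def aMap (u : E.CStar) (e f : Ed) : E.CStar →ₗ[ℂ] E.CStar :=
  (LinearMap.mulLeft ℂ (star (E.S e) * star u)).comp (LinearMap.mulRight ℂ (u * E.S f))

theorem aMap_apply (u : E.CStar) (e f : Ed) (x : E.CStar) :
    aMap u e f x = star (E.S e) * star u * x * u * E.S f := by
  simp [aMap, mul_assoc]

theorem Path.P_mul_S {k : ℕ} {v : V} (μ : E.Path k v) : E.P v * μ.S = μ.S := by
  cases μ with
  | nil => exact E.P_mul_self v
  | cons e h μ =>
    subst h
    rw [Path.S, ← mul_assoc, E.P_mul_S]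

theorem Path.star_S_mul_P {k : ℕ} {v : V} (μ : E.Path k v) : star μ.S * E.P v = star μ.S := by
  rw [← E.star_P, ← star_mul, μ.P_mul_S]

theorem conj_S_mem_Dk {k : ℕ} (e : Ed) {x : E.CStar} (hx : x ∈ E.Dk k) :
    E.S e * x * star (E.S e) ∈ E.Dk (k + 1) := by
  induction hx using Submodule.span_induction with
  | mem x hx =>
    obtain ⟨v, μ, rfl⟩ := hx
    by_cases hv : v = E.r e
    · subst hv
      refine Submodule.subset_span ⟨E.s e, .cons e rfl μ, ?_⟩
      simp only [Path.S, star_mul, mul_assoc]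
    · rw [← μ.P_mul_S, ← mul_assoc, ← mul_assoc, E.S_mul_P_of_ne hv]
      simp
  | zero => simp
  | add x y _ _ hx hy => simpa only [mul_add, add_mul] using add_mem hx hy
  | smul c x _ hx =>
    simpa only [mul_smul_comm, smul_mul_assoc] using Submodule.smul_mem _ c hx

theorem conj_star_mem_Dk {k : ℕ} (hN : u ∈ E.normalizer (E.Fk k) (E.Dk k)) {x : E.CStar}
    (hx : x ∈ E.Dk k) : star u * x * u ∈ E.Dk k := by
  have hx' : x ∈ (fun x => u * x * star u) '' (E.Dk k : Set E.CStar) := by rw [hN.2.2]; exact hx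
  obtain ⟨y, hy, rfl⟩ := hx'
  have h1 : star u * (u * y * star u) * u = (star u * u) * y * (star u * u) := by
    simp only [mul_assoc]
  change star u * (u * y * star u) * u ∈ _
  rw [h1, Unitary.star_mul_self_of_mem hN.2.1, one_mul, mul_one]
  exact hy

theorem star_S_mul_mul_S_mem_Dk {k : ℕ} (e f : Ed) {x : E.CStar} (hx : x ∈ E.Dk (k + 1)) :
    star (E.S e) * x * E.S f ∈ E.Dk k := by
  induction hx using Submodule.span_induction with
  | mem x hx =>
    obtain ⟨v, μ, rfl⟩ := hx
    cases μ with
    | cons g h μ =>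
      have h1 : star (E.S e) * (Path.S (.cons g h μ) * star (Path.S (.cons g h μ))) * E.S f =
          (star (E.S e) * E.S g) * (μ.S * star μ.S) * (star (E.S g) * E.S f) := by
        simp only [Path.S, star_mul, mul_assoc]
      rw [h1]
      by_cases heg : e = g
      · by_cases hgf : g = f
        · subst heg hgf
          rw [E.isCKFamily_PS.star_mul_self, ← mul_assoc, μ.P_mul_S, mul_assoc, μ.star_S_mul_P]
          exact Submodule.subset_span ⟨_, μ, rfl⟩
        · rw [E.isCKFamily_PS.star_mul_of_ne g f hgf, mul_zero]
          exact zero_mem _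
      · rw [E.isCKFamily_PS.star_mul_of_ne e g heg, zero_mul, zero_mul]
        exact zero_mem _
  | zero => simp
  | add x y _ _ hx hy => simpa only [mul_add, add_mul] using add_mem hx hy
  | smul c x _ hx =>
    simpa only [mul_smul_comm, smul_mul_assoc] using Submodule.smul_mem _ c hx

variable [Fintype Ed]

/-- In the absence of sinks, `D_E^k ⊆ D_E^{k+1}`. -/
theorem Dk_le_succ (hE : E.NoSinks) (k : ℕ) : E.Dk k ≤ E.Dk (k + 1) := by
  refine Submodule.span_le.2 ?_
  rintro _ ⟨v, μ, rfl⟩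
  change μ.S * star μ.S ∈ E.Dk (k + 1)
  induction μ with
  | nil v =>
    have h := E.isCKFamily_PS.sum_range v (Set.toFinite _) (hE v)
    rw [Path.S, E.star_P, E.P_mul_self, h]
    refine Submodule.sum_mem _ fun e he => ?_
    have he' : E.s e = v := by simpa using he
    refine Submodule.subset_span ⟨v, .cons e he' (.nil _), ?_⟩
    simp only [Path.S, E.S_mul_P]
  | cons e h μ ih =>
    have := conj_S_mem_Dk e ih
    simpa only [Path.S, star_mul, mul_assoc] using this

/-- The maps `a^u_{e,f}` leave `D_E^{k-1}` invariant. -/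
theorem aMap_mem_Dk (hE : E.NoSinks) {k : ℕ} (hk : 1 ≤ k)
    (hN : u ∈ E.normalizer (E.Fk k) (E.Dk k)) (e f : Ed) (x : E.CStar) (hx : x ∈ E.Dk (k - 1)) :
    aMap u e f x ∈ E.Dk (k - 1) := by
  obtain ⟨n, rfl⟩ := Nat.exists_eq_add_of_le' hk
  rw [Nat.add_sub_cancel] at hx ⊢
  have h1 : aMap u e f x = star (E.S e) * (star u * x * u) * E.S f := by
    simp only [aMap_apply, mul_assoc]
  rw [h1]
  exact star_S_mul_mul_S_mem_Dk e f (conj_star_mem_Dk hN (Dk_le_succ hE n hx))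

/-- The maps `a^u_{e,f}` leave `D_E^0` invariant. -/
theorem aMap_mem_Dk_zero (hE : E.NoSinks) (hu : u ∈ E.UE) (e f : Ed) (x : E.CStar)
    (hx : x ∈ E.Dk 0) : aMap u e f x ∈ E.Dk 0 := by
  have h1 : star u * x * u = x := by
    induction hx using Submodule.span_induction with
    | mem x hx =>
      obtain ⟨v, μ, rfl⟩ := hx
      cases μ
      rw [Path.S, E.star_P, E.P_mul_self, mul_assoc, ← hu.2, ← mul_assoc,
        Unitary.star_mul_self_of_mem hu.1, one_mul]
    | zero => simp
    | add x y _ _ hx hy => rw [mul_add, add_mul, hx, hy]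
    | smul c x _ hx => rw [mul_smul_comm, smul_mul_assoc, hx]
  have h2 : aMap u e f x = star (E.S e) * (star u * x * u) * E.S f := by
    simp only [aMap_apply, mul_assoc]
  rw [h2, h1]
  exact star_S_mul_mul_S_mem_Dk e f (Dk_le_succ hE 0 hx)

/-- The restriction `b^u_{e,f}` of `a^u_{e,f}` to `D_E^{k-1}`. -/
noncomputable def bMap (hE : E.NoSinks) {k : ℕ} (hk : 1 ≤ k)
    (hN : u ∈ E.normalizer (E.Fk k) (E.Dk k)) (e f : Ed) : E.Dk (k - 1) →ₗ[ℂ] E.Dk (k - 1) :=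
  (aMap u e f).restrict (aMap_mem_Dk hE hk hN e f)

variable (E) in
/-- The quotient space `V_k^D = D_E^{k-1} / D_E^0`. -/
abbrev VD (k : ℕ) : Type (max u v + 1) := E.Dk (k - 1) ⧸ (E.Dk 0).submoduleOf (E.Dk (k - 1))

/-- The map `b̃^u_{e,f}` induced by `b^u_{e,f}` on `V_k^D = D_E^{k-1} / D_E^0`. -/
noncomputable def bTilde (hE : E.NoSinks) {k : ℕ} (hk : 1 ≤ k) (hu : u ∈ E.UE)
    (hN : u ∈ E.normalizer (E.Fk k) (E.Dk k)) (e f : Ed) : Module.End ℂ (E.VD k) :=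
  Submodule.mapQ _ _ (bMap hE hk hN e f) fun x hx => aMap_mem_Dk_zero hE hu e f x hx

/-- The ring `A_u^D`, the (not necessarily unital) subring of the ring of linear maps on `V_k^D`
that is generated by the maps `b̃^u_{e,f}`. -/
noncomputable def AD (hE : E.NoSinks) {k : ℕ} (hk : 1 ≤ k) (hu : u ∈ E.UE)
    (hN : u ∈ E.normalizer (E.Fk k) (E.Dk k)) : NonUnitalSubring (Module.End ℂ (E.VD k)) :=
  NonUnitalSubring.closure {b | ∃ e f : Ed, b = bTilde hE hk hu hN e f}

/-! ### The subspaces `Ξ_r^D` -/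

variable (E) in
/-- `H`, the linear span of the generators `S_e`. -/
noncomputable def spanS : Submodule ℂ E.CStar := Submodule.span ℂ (Set.range E.S)

/-- The subspaces `Ξ_r^D`: `Ξ_0^D = D_E^{k-1}` and `Ξ_{r+1}^D = λ_u(H)^* Ξ_r^D λ_u(H)`. -/
noncomputable def XiD (hu : u ∈ E.UE) (k : ℕ) : ℕ → Submodule ℂ E.CStar
  | 0 => E.Dk (k - 1)
  | r + 1 => Submodule.span ℂ {y | ∃ g ∈ E.spanS, ∃ x ∈ XiD hu k r, ∃ h ∈ E.spanS,
      y = star (lam hu g) * x * lam hu h}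

/-- `Ξ_u^D`, the intersection of all `Ξ_r^D`. -/
noncomputable def XiDInf (hu : u ∈ E.UE) (k : ℕ) : Submodule ℂ E.CStar := ⨅ r, XiD hu k r

end Finite

end DirectedGraph

/-- A ring without unit `A`, given as a subring of a ring `R`, is nilpotent if `A ^ l = 0` for
some `l ≥ 1`, that is, if all products of `l` elements of `A` vanish. -/
def NonUnitalSubring.IsNilpotentRing {R : Type w} [Ring R] (A : NonUnitalSubring R) : Prop :=
  ∃ l : ℕ, 1 ≤ l ∧ ∀ L : List R, L.length = l → (∀ a ∈ L, a ∈ A) → L.prod = 0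

namespace DirectedGraph

variable {V : Type u} {Ed : Type v} {E : DirectedGraph V Ed}

/-! ### The finite-dimensional diagonal algebras -/

/-! Everything rests on the block decomposition `x = ∑ S_e (S_e^* x S_e) S_e^*` for `x ∈ D^{m+1}`
(`eq_sum_conj_S`), whose blocks lie in `D^m`. It shows by induction that the `D^m` are
finite-dimensional commutative algebras. They increase, and their union is dense in `D_E`.

On `D^r` the endomorphism `λ_u` is conjugation by a unitary (`exists_lam_eq_conj`). It is therefore
isometric on `D_E`, hence injective there with closed image. Since `u` also normalizes `D^m` for
every `m ≥ k` (`conj_mem_Dk_of_le`), `λ_u` maps `D_E` into itself, and only surjectivity is at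
stake.

The compressions `a_{e,e}(x) = S_e^* u^* x u S_e` undo `λ_u` one edge at a time: `a_{e,e}(λ_u(y)) =
λ_u(S_e^* y S_e)`. Conversely, if every `a_{e,e}(x)` is some `λ_u(z_e)`, then `x = λ_u(∑ S_e z_e
S_e^*)` (`mem_lam_image_of_forall_aMap`). If `Ξ_r ⊆ D^0`, which `λ_u` fixes, this puts `Ξ_r`, then
`Ξ_{r-1}`, down to `Ξ_0 = D^{k-1}` in the image, then every higher `D^m`, and closedness gives
`D_E`.

If `λ_u` is onto `D_E`, each `P_μ` with `|μ| = k-1` is within `1/2` of some `λ_u(D^n)`. Each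
`a_{e,e}` keeps such elements projections in `D^{k-1}` and lowers `n` by one
(`aMap_mem_nearProjections`). At `n = 0` they are within `1/2` of `D^0`, which forces them into
`D^0`. So `Ξ_N ⊆ D^0` for some `N`.

The `Ξ_r` decrease inside a finite-dimensional space, so `Ξ_u ⊆ D^0` means `Ξ_r ⊆ D^0` for some `r`.
Modulo `D^0`, `Ξ_r` is the sum of the ranges of the products of `r` generators of `A_u^D`, so this
is nilpotency (`isNilpotentRing_AD_iff`). -/

theorem sum_S_mul_star_S [Fintype V] [Fintype Ed] (hE : E.NoSinks) :
    ∑ e, E.S e * star (E.S e) = 1 := by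
  classical
  rw [E.one_eq, ← Finset.sum_fiberwise Finset.univ E.s]
  refine Finset.sum_congr rfl fun v _ => ?_
  rw [E.isCKFamily_PS.sum_range v (Set.toFinite _) (hE v)]
  exact Finset.sum_congr (by ext; simp) fun _ _ => rfl

theorem star_S_mul_mul_S_of_ne {k : ℕ} {e f : Ed} (hef : e ≠ f) {x : E.CStar}
    (hx : x ∈ E.Dk (k + 1)) : star (E.S e) * x * E.S f = 0 := by
  induction hx using Submodule.span_induction with
  | mem x hx =>
    obtain ⟨v, μ, rfl⟩ := hx
    cases μ with
    | cons g h μ =>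
      have h1 : star (E.S e) * (Path.S (.cons g h μ) * star (Path.S (.cons g h μ))) * E.S f =
          (star (E.S e) * E.S g) * (μ.S * star μ.S) * (star (E.S g) * E.S f) := by
        simp only [Path.S, star_mul, mul_assoc]
      rw [h1]
      by_cases heg : e = g
      · subst heg
        rw [E.isCKFamily_PS.star_mul_of_ne e f hef, mul_zero]
      · rw [E.isCKFamily_PS.star_mul_of_ne e g heg, zero_mul, zero_mul]
  | zero => simp
  | add x y _ _ hx hy => rw [mul_add, add_mul, hx, hy, add_zero]
  | smul c x _ hx => rw [mul_smul_comm, smul_mul_assoc, hx, smul_zero]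

/-- Insert `1 = ∑ S_e S_e^*` on both sides; the off-diagonal blocks vanish. This reduces statements
about `D^{k+1}` to statements about `D^k`. -/
theorem eq_sum_conj_S [Fintype V] [Fintype Ed] (hE : E.NoSinks) {k : ℕ} {x : E.CStar}
    (hx : x ∈ E.Dk (k + 1)) :
    x = ∑ e, E.S e * (star (E.S e) * x * E.S e) * star (E.S e) := by
  have h1 : x = (∑ e, E.S e * star (E.S e)) * x * ∑ e, E.S e * star (E.S e) := by
    rw [sum_S_mul_star_S hE, one_mul, mul_one]
  conv_lhs => rw [h1, Finset.sum_mul, Finset.sum_mul]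
  refine Finset.sum_congr rfl fun e _ => ?_
  rw [Finset.mul_sum, Finset.sum_eq_single e]
  · simp only [mul_assoc]
  · intro f _ hf
    have := star_S_mul_mul_S_of_ne hf.symm hx
    calc _ = E.S e * (star (E.S e) * x * E.S f) * star (E.S f) := by simp only [mul_assoc]
      _ = 0 := by rw [this, mul_zero, zero_mul]
  · simp

theorem P_mem_Dk_zero (v : V) : E.P v ∈ E.Dk 0 :=
  Submodule.subset_span ⟨v, .nil v, by rw [Path.S, E.star_P, E.P_mul_self]⟩

theorem Dk_zero_eq : E.Dk 0 = Submodule.span ℂ (Set.range E.P) := by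
  refine le_antisymm (Submodule.span_le.2 ?_) (Submodule.span_le.2 ?_)
  · rintro _ ⟨v, μ, rfl⟩
    cases μ
    exact Submodule.subset_span ⟨v, by rw [Path.S, E.star_P, E.P_mul_self]⟩
  · rintro _ ⟨v, rfl⟩
    exact P_mem_Dk_zero v

theorem star_mem_Dk {k : ℕ} {x : E.CStar} (hx : x ∈ E.Dk k) : star x ∈ E.Dk k := by
  induction hx using Submodule.span_induction with
  | mem x hx =>
    obtain ⟨v, μ, rfl⟩ := hx
    exact Submodule.subset_span ⟨v, μ, by rw [star_mul, star_star]⟩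
  | zero => simp
  | add x y _ _ hx hy => rw [star_add]; exact add_mem hx hy
  | smul c x _ hx => rw [star_smul]; exact Submodule.smul_mem _ _ hx

/-- Multiplication by a vertex projection from either side on an element of `D_E^0`. -/
theorem mul_P_of_mem_Dk_zero {x : E.CStar} (hx : x ∈ E.Dk 0) (v : V) :
    ∃ c : ℂ, x * E.P v = c • E.P v ∧ E.P v * x = c • E.P v := by
  rw [Dk_zero_eq] at hx
  induction hx using Submodule.span_induction with
  | mem x hx =>
    obtain ⟨w, rfl⟩ := hx
    by_cases h : w = v
    · subst h
      exact ⟨1, by rw [E.P_mul_self, one_smul], by rw [E.P_mul_self, one_smul]⟩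
    · exact ⟨0, by rw [E.P_mul_of_ne h, zero_smul], by rw [E.P_mul_of_ne (Ne.symm h), zero_smul]⟩
  | zero => exact ⟨0, by simp, by simp⟩
  | add x y _ _ hx hy =>
    obtain ⟨a, ha, ha'⟩ := hx
    obtain ⟨b, hb, hb'⟩ := hy
    exact ⟨a + b, by rw [add_mul, ha, hb, add_smul], by rw [mul_add, ha', hb', add_smul]⟩
  | smul c x _ hx =>
    obtain ⟨a, ha, ha'⟩ := hx
    exact ⟨c * a, by rw [smul_mul_assoc, ha, smul_smul], by rw [mul_smul_comm, ha', smul_smul]⟩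

theorem conj_S_mul_conj_S (e f : Ed) (x y : E.CStar) :
    E.S e * x * star (E.S e) * (E.S f * y * star (E.S f)) =
      E.S e * (x * (star (E.S e) * E.S f) * y) * star (E.S f) := by
  simp only [mul_assoc]

section Finite

variable [Fintype V] [Fintype Ed]

/-- Block-diagonal elements multiply blockwise, so closure under products and commutativity pass
from one level to the next. -/
theorem mul_eq_sum (hE : E.NoSinks) {k : ℕ} {x y : E.CStar} (hx : x ∈ E.Dk (k + 1))
    (hy : y ∈ E.Dk (k + 1)) : x * y =
      ∑ e, E.S e * ((star (E.S e) * x * E.S e) * (star (E.S e) * y * E.S e)) * star (E.S e) := by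
  conv_lhs => rw [eq_sum_conj_S hE hx, Finset.sum_mul]
  refine Finset.sum_congr rfl fun e _ => ?_
  conv_lhs => rw [eq_sum_conj_S hE hy, Finset.mul_sum]
  rw [Finset.sum_eq_single e]
  · rw [conj_S_mul_conj_S]
    rw [E.isCKFamily_PS.star_mul_self, mul_assoc (star (E.S e) * x), E.S_mul_P]
  · intro f _ hf
    rw [conj_S_mul_conj_S, E.isCKFamily_PS.star_mul_of_ne e f hf.symm]
    simp
  · simp

theorem mul_mem_Dk (hE : E.NoSinks) {k : ℕ} {x y : E.CStar} (hx : x ∈ E.Dk k)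
    (hy : y ∈ E.Dk k) : x * y ∈ E.Dk k := by
  induction k generalizing x y with
  | zero =>
    rw [← mul_one (x * y), E.one_eq, Finset.mul_sum]
    refine Submodule.sum_mem _ fun v _ => ?_
    obtain ⟨a, ha, -⟩ := mul_P_of_mem_Dk_zero hx v
    obtain ⟨b, hb, -⟩ := mul_P_of_mem_Dk_zero hy v
    rw [mul_assoc, hb, mul_smul_comm, ha]
    exact Submodule.smul_mem _ _ (Submodule.smul_mem _ _ (P_mem_Dk_zero v))
  | succ k ih =>
    rw [mul_eq_sum hE hx hy]
    exact Submodule.sum_mem _ fun e _ => conj_S_mem_Dk e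
      (ih (star_S_mul_mul_S_mem_Dk e e hx) (star_S_mul_mul_S_mem_Dk e e hy))

theorem mul_comm_of_mem_Dk (hE : E.NoSinks) {k : ℕ} {x y : E.CStar} (hx : x ∈ E.Dk k)
    (hy : y ∈ E.Dk k) : x * y = y * x := by
  induction k generalizing x y with
  | zero =>
    rw [← mul_one (x * y), ← mul_one (y * x), E.one_eq, Finset.mul_sum, Finset.mul_sum]
    refine Finset.sum_congr rfl fun v _ => ?_
    obtain ⟨a, ha, -⟩ := mul_P_of_mem_Dk_zero hx v
    obtain ⟨b, hb, -⟩ := mul_P_of_mem_Dk_zero hy v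
    rw [mul_assoc, hb, mul_smul_comm, ha, mul_assoc, ha, mul_smul_comm, hb, smul_comm]
  | succ k ih =>
    rw [mul_eq_sum hE hx hy, mul_eq_sum hE hy hx]
    exact Finset.sum_congr rfl fun e _ => by
      rw [ih (star_S_mul_mul_S_mem_Dk e e hx) (star_S_mul_mul_S_mem_Dk e e hy)]

theorem Dk_mono (hE : E.NoSinks) : Monotone E.Dk := monotone_nat_of_le_succ (Dk_le_succ hE)

theorem finiteDimensional_Dk (hE : E.NoSinks) (k : ℕ) : FiniteDimensional ℂ (E.Dk k) := by
  induction k with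
  | zero =>
    rw [Dk_zero_eq]
    exact FiniteDimensional.span_of_finite ℂ (Set.finite_range _)
  | succ k ih =>
    let c (e : Ed) : E.CStar →ₗ[ℂ] E.CStar :=
      (LinearMap.mulLeft ℂ (E.S e)).comp (LinearMap.mulRight ℂ (star (E.S e)))
    have h1 : E.Dk (k + 1) ≤ ⨆ e, (E.Dk k).map (c e) := by
      intro x hx
      rw [eq_sum_conj_S hE hx]
      refine Submodule.sum_mem _ fun e _ => Submodule.mem_iSup_of_mem e
        ⟨_, star_S_mul_mul_S_mem_Dk e e hx, ?_⟩
      simp [c, mul_assoc]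
    exact Submodule.finiteDimensional_of_le h1

/-- Each `D_E^k` is contained in `D_E`, and their union is dense. -/
theorem coe_diagonal (hE : E.NoSinks) :
    (E.diagonal : Set E.CStar) = closure (⋃ k, (E.Dk k : Set E.CStar)) := by
  -- The union of the increasing `D^k` is already a `*`-subalgebra, so it equals the one generated
  -- by the `P_μ`.
  let B : NonUnitalStarSubalgebra ℂ E.CStar :=
    { carrier := ⋃ k, (E.Dk k : Set E.CStar)
      add_mem' := by
        intro a b ha hb
        rw [Set.mem_iUnion] at ha hb ⊢
        obtain ⟨i, hi⟩ := ha
        obtain ⟨j, hj⟩ := hb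
        exact ⟨max i j, add_mem (Dk_mono hE (le_max_left i j) hi)
          (Dk_mono hE (le_max_right i j) hj)⟩
      zero_mem' := Set.mem_iUnion.2 ⟨0, zero_mem _⟩
      mul_mem' := by
        intro a b ha hb
        rw [Set.mem_iUnion] at ha hb ⊢
        obtain ⟨i, hi⟩ := ha
        obtain ⟨j, hj⟩ := hb
        exact ⟨max i j, mul_mem_Dk hE (Dk_mono hE (le_max_left i j) hi)
          (Dk_mono hE (le_max_right i j) hj)⟩
      smul_mem' := by
        intro c a ha
        rw [Set.mem_iUnion] at ha ⊢
        obtain ⟨i, hi⟩ := ha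
        exact ⟨i, Submodule.smul_mem _ c hi⟩
      star_mem' := by
        intro a ha
        rw [Set.mem_iUnion] at ha ⊢
        obtain ⟨i, hi⟩ := ha
        exact ⟨i, star_mem_Dk hi⟩ }
  have hB : NonUnitalStarAlgebra.adjoin ℂ
      {x | ∃ (k : ℕ) (v : V) (μ : E.Path k v), x = μ.S * star μ.S} = B := by
    refine le_antisymm (NonUnitalStarAlgebra.adjoin_le ?_) ?_
    · rintro _ ⟨k, v, μ, rfl⟩
      exact Set.mem_iUnion.2 ⟨k, Submodule.subset_span ⟨v, μ, rfl⟩⟩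
    · intro x hx
      obtain ⟨k, hk⟩ := Set.mem_iUnion.1 (show x ∈ ⋃ k, (E.Dk k : Set E.CStar) from hx)
      clear hx
      induction hk using Submodule.span_induction with
      | mem x hx =>
        obtain ⟨v, μ, rfl⟩ := hx
        exact NonUnitalStarAlgebra.subset_adjoin ℂ _ ⟨k, v, μ, rfl⟩
      | zero => exact zero_mem _
      | add x y _ _ hx hy =>
        exact add_mem hx hy
      | smul c x _ hx => exact SMulMemClass.smul_mem c hx
  rw [diagonal, hB]
  rfl

theorem Dk_subset_diagonal (hE : E.NoSinks) {k : ℕ} {x : E.CStar} (hx : x ∈ E.Dk k) :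
    x ∈ E.diagonal := by
  rw [← SetLike.mem_coe, coe_diagonal hE]
  exact subset_closure (Set.mem_iUnion.2 ⟨k, hx⟩)

theorem exists_mem_Dk_norm_sub_lt (hE : E.NoSinks) {x : E.CStar} (hx : x ∈ E.diagonal) {ε : ℝ}
    (hε : 0 < ε) : ∃ k, ∃ y ∈ E.Dk k, ‖x - y‖ < ε := by
  rw [← SetLike.mem_coe, coe_diagonal hE] at hx
  obtain ⟨y, hy, h⟩ := Metric.mem_closure_iff.1 hx ε hε
  obtain ⟨k, hk⟩ := Set.mem_iUnion.1 hy
  exact ⟨k, y, hk, by rwa [← dist_eq_norm]⟩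

theorem conj_S_mem_diagonal (hE : E.NoSinks) (e : Ed) {x : E.CStar} (hx : x ∈ E.diagonal) :
    E.S e * x * star (E.S e) ∈ E.diagonal := by
  rw [← SetLike.mem_coe, coe_diagonal hE] at hx ⊢
  refine map_mem_closure (f := fun x => E.S e * x * star (E.S e)) (by fun_prop) hx fun y hy => ?_
  obtain ⟨k, hk⟩ := Set.mem_iUnion.1 hy
  exact Set.mem_iUnion.2 ⟨k + 1, conj_S_mem_Dk e hk⟩

end Finite

end DirectedGraph

namespace DirectedGraph

variable {V : Type u} {Ed : Type v} {E : DirectedGraph V Ed} [Fintype V]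

/-! ### Matrix coefficients with respect to paths of a given length -/

/-- The first edge and the remainder of a path of positive length. -/
def Path.uncons {k : ℕ} : (Σ v, E.Path (k + 1) v) → Ed × Σ v, E.Path k v
  | ⟨_, .cons e _ μ⟩ => (e, ⟨_, μ⟩)

theorem S_mul_Path_S_of_ne {k : ℕ} {v : V} {e : Ed} (h : v ≠ E.r e) (μ : E.Path k v) :
    E.S e * μ.S = 0 := by
  rw [← μ.P_mul_S, ← mul_assoc, E.S_mul_P_of_ne h, zero_mul]

theorem star_Path_S_mul_star_S_of_ne {k : ℕ} {v : V} {e : Ed} (h : v ≠ E.r e)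
    (μ : E.Path k v) : star μ.S * star (E.S e) = 0 := by
  rw [← star_mul, S_mul_Path_S_of_ne h, star_zero]

/-- For paths of equal length the product is the range projection of `μ` if the paths agree, and
zero otherwise. -/
theorem star_Path_S_mul_Path_S_mem {k : ℕ} {v w : V} (μ : E.Path k v) (ν : E.Path k w) :
    star μ.S * ν.S ∈ E.Dk 0 := by
  induction μ generalizing w with
  | nil v =>
    cases ν
    rw [Path.S, Path.S, E.star_P]
    by_cases h : v = w
    · subst h
      rw [E.P_mul_self]
      exact P_mem_Dk_zero v
    · rw [E.P_mul_of_ne h]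
      exact zero_mem _
  | cons e h μ ih =>
    cases ν with
    | cons f h' ν =>
      have h1 : star (Path.S (.cons e h μ)) * Path.S (.cons f h' ν) =
          star μ.S * (star (E.S e) * E.S f) * ν.S := by
        simp only [Path.S, star_mul, mul_assoc]
      rw [h1]
      by_cases hef : e = f
      · subst hef
        rw [E.isCKFamily_PS.star_mul_self, μ.star_S_mul_P]
        exact ih ν
      · rw [E.isCKFamily_PS.star_mul_of_ne e f hef]
        simp

theorem star_Path_S_mul_mul_Path_S_of_ne {k : ℕ} {v w : V} (μ : E.Path k v) (ν : E.Path k w)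
    (h : (⟨v, μ⟩ : Σ v, E.Path k v) ≠ ⟨w, ν⟩) {x : E.CStar} (hx : x ∈ E.Dk k) :
    star μ.S * x * ν.S = 0 := by
  induction μ generalizing w x with
  | nil v =>
    cases ν
    rw [Path.S, Path.S, E.star_P]
    have hvw : v ≠ w := by
      rintro rfl
      exact h rfl
    obtain ⟨c, -, hc⟩ := mul_P_of_mem_Dk_zero hx v
    rw [hc, smul_mul_assoc, E.P_mul_of_ne hvw, smul_zero]
  | cons e he μ ih =>
    cases ν with
    | cons f hf ν =>
      have h1 : star (Path.S (.cons e he μ)) * x * Path.S (.cons f hf ν) =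
          star μ.S * (star (E.S e) * x * E.S f) * ν.S := by
        simp only [Path.S, star_mul, mul_assoc]
      rw [h1]
      by_cases hef : e = f
      · subst hef
        refine ih ν (fun h2 => h ?_) (star_S_mul_mul_S_mem_Dk e e hx)
        subst he hf
        cases h2
        rfl
      · rw [star_S_mul_mul_S_of_ne hef hx, mul_zero, zero_mul]

/-- On a spanning element `S_α S_β^*` the coefficient is a product of two elements of `D^0`.
Coefficients in `D^0` commute with every `D^j`, which is what is needed to normalize higher levels.
-/
theorem star_Path_S_mul_mul_Path_S_mem_of_mem_Fk [Fintype Ed] (hE : E.NoSinks) {k : ℕ} {v w : V} (μ : E.Path k v)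
    (ν : E.Path k w) {x : E.CStar} (hx : x ∈ E.Fk k) :
    star μ.S * x * ν.S ∈ E.Dk 0 := by
  induction hx using Submodule.span_induction with
  | mem x hx =>
    obtain ⟨_, _, α, β, rfl⟩ := hx
    have := mul_mem_Dk hE (star_Path_S_mul_Path_S_mem μ α) (star_Path_S_mul_Path_S_mem β ν)
    simpa only [mul_assoc] using this
  | zero => simp
  | add x y _ _ hx hy => simpa only [mul_add, add_mul] using add_mem hx hy
  | smul c x _ hx =>
    simpa only [mul_smul_comm, smul_mul_assoc] using Submodule.smul_mem _ c hx

theorem star_mem_Fk {k : ℕ} {x : E.CStar} (hx : x ∈ E.Fk k) : star x ∈ E.Fk k := by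
  induction hx using Submodule.span_induction with
  | mem x hx =>
    obtain ⟨v, w, μ, ν, rfl⟩ := hx
    exact Submodule.subset_span ⟨w, v, ν, μ, by rw [star_mul, star_star]⟩
  | zero => simp
  | add x y _ _ hx hy => rw [star_add]; exact add_mem hx hy
  | smul c x _ hx => rw [star_smul]; exact Submodule.smul_mem _ _ hx

theorem lam_conj_S {u : E.CStar} (hu : u ∈ E.UE) (e : Ed) (x : E.CStar) :
    lam hu (E.S e * x * star (E.S e)) =
      u * (E.S e * lam hu x * star (E.S e)) * star u := by
  rw [map_mul, map_mul, map_star, lam_S, star_mul]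
  simp only [mul_assoc]

theorem lam_eq_self_of_mem_Dk_zero {u : E.CStar} (hu : u ∈ E.UE) {x : E.CStar} (hx : x ∈ E.Dk 0) :
    lam hu x = x := by
  rw [Dk_zero_eq] at hx
  induction hx using Submodule.span_induction with
  | mem x hx =>
    obtain ⟨v, rfl⟩ := hx
    exact lam_P hu v
  | zero => simp
  | add x y _ _ hx hy => rw [map_add, hx, hy]
  | smul c x _ hx => rw [map_smul, hx]

theorem continuous_lam {u : E.CStar} (hu : u ∈ E.UE) : Continuous (lam hu) :=
  AddMonoidHomClass.continuous_of_bound (lam hu) 1 fun x => by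
    simpa using NonUnitalStarAlgHom.norm_apply_le (lam hu) x

theorem isClosed_diagonal : IsClosed (E.diagonal : Set E.CStar) :=
  NonUnitalStarSubalgebra.isClosed_topologicalClosure _

section FiniteEdges

variable [Fintype Ed]

/-- The range projections of the paths of length `k` sum to `1`; the induction peels off first
edges. -/
theorem eq_zero_of_mul_Path_S (hE : E.NoSinks) (k : ℕ) {x : E.CStar}
    (h : ∀ (v : V) (μ : E.Path k v), x * μ.S = 0) : x = 0 := by
  induction k generalizing x with
  | zero =>
    rw [← mul_one x, E.one_eq, Finset.mul_sum]
    exact Finset.sum_eq_zero fun v _ => h v (.nil v)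
  | succ k ih =>
    rw [← mul_one x, ← sum_S_mul_star_S hE, Finset.mul_sum]
    refine Finset.sum_eq_zero fun e _ => ?_
    have h1 : x * E.S e = 0 := ih fun v μ => by
      by_cases hv : v = E.r e
      · subst hv
        rw [mul_assoc]
        exact h _ (.cons e rfl μ)
      · rw [mul_assoc, S_mul_Path_S_of_ne hv, mul_zero]
    rw [← mul_assoc, h1, zero_mul]

/-- A matrix indexed by paths of length `k` that is diagonal with entries in `D^j` is a sum of terms
`S_μ y S_μ^*`, and each of these lies in `D^{j+k}`. -/
theorem mem_Dk_add_of_coeff (hE : E.NoSinks) (j k : ℕ) {x : E.CStar}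
    (hd : ∀ (v : V) (μ : E.Path k v), star μ.S * x * μ.S ∈ E.Dk j)
    (ho : ∀ (v w : V) (μ : E.Path k v) (ν : E.Path k w),
      (⟨v, μ⟩ : Σ v, E.Path k v) ≠ ⟨w, ν⟩ → star μ.S * x * ν.S = 0) : x ∈ E.Dk (j + k) := by
  induction k generalizing x with
  | zero =>
    have h1 : x = ∑ v, E.P v * x * E.P v := by
      have h2 : x = (∑ v, E.P v) * x * ∑ v, E.P v := by
        rw [← E.one_eq, one_mul, mul_one]
      conv_lhs => rw [h2, Finset.sum_mul, Finset.sum_mul]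
      refine Finset.sum_congr rfl fun v _ => ?_
      rw [Finset.mul_sum, Finset.sum_eq_single v]
      · intro w _ hw
        have := ho v w (.nil v) (.nil w) fun h => hw (congrArg Sigma.fst h).symm
        rwa [Path.S, Path.S, E.star_P] at this
      · simp
    rw [h1]
    refine Submodule.sum_mem _ fun v _ => ?_
    have := hd v (.nil v)
    rwa [Path.S, E.star_P] at this
  | succ k ih =>
    have key : ∀ (e f : Ed) (v w : V) (μ : E.Path k v) (ν : E.Path k w),
        (⟨e, v, μ⟩ : Ed × Σ v, E.Path k v) ≠ ⟨f, w, ν⟩ →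
        star μ.S * (star (E.S e) * x * E.S f) * ν.S = 0 := by
      intro e f v w μ ν h
      by_cases hv : v = E.r e
      · by_cases hw : w = E.r f
        · subst hv hw
          have := ho _ _ (.cons e rfl μ) (.cons f rfl ν) fun h2 => h (congrArg Path.uncons h2)
          simpa only [Path.S, star_mul, mul_assoc] using this
        · rw [mul_assoc, mul_assoc _ (E.S f), S_mul_Path_S_of_ne hw]
          simp
      · simp only [← mul_assoc]
        rw [star_Path_S_mul_star_S_of_ne hv]
        simp
    -- All coefficients of this block vanish; cancel the paths on the right and, after taking
    -- adjoints, on the left.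
    have hz : ∀ e f, e ≠ f → star (E.S e) * x * E.S f = 0 := fun e f hef =>
      eq_zero_of_mul_Path_S hE k fun w ν => star_injective <| by
        rw [star_zero]
        refine eq_zero_of_mul_Path_S hE k fun v μ => star_injective ?_
        have := key e f v w μ ν fun h => hef (congrArg Prod.fst h)
        rw [star_mul, star_star, star_zero, ← mul_assoc, this]
    have h1 : x = ∑ e, E.S e * (star (E.S e) * x * E.S e) * star (E.S e) := by
      have h2 : x = (∑ e, E.S e * star (E.S e)) * x * ∑ e, E.S e * star (E.S e) := by
        rw [sum_S_mul_star_S hE, one_mul, mul_one]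
      conv_lhs => rw [h2, Finset.sum_mul, Finset.sum_mul]
      refine Finset.sum_congr rfl fun e _ => ?_
      rw [Finset.mul_sum, Finset.sum_eq_single e]
      · simp only [mul_assoc]
      · intro f _ hf
        calc _ = E.S e * (star (E.S e) * x * E.S f) * star (E.S f) := by simp only [mul_assoc]
          _ = 0 := by rw [hz e f hf.symm, mul_zero, zero_mul]
      · simp
    rw [h1]
    refine Submodule.sum_mem _ fun e _ => conj_S_mem_Dk (k := j + k) e (ih ?_ ?_)
    · intro v μ
      by_cases hv : v = E.r e
      · subst hv
        have := hd _ (.cons e rfl μ)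
        simpa only [Path.S, star_mul, mul_assoc] using this
      · rw [mul_assoc, mul_assoc _ (E.S e), S_mul_Path_S_of_ne hv]
        simp
    · exact fun v w μ ν h => key e e v w μ ν fun h2 => h (congrArg Prod.snd h2)

/-- Cut a path of length `j + k` after its first `k` edges: `μ` is the initial piece and `y` carries
the tail. -/
theorem Dk_add_le_span (hE : E.NoSinks) (j k : ℕ) : E.Dk (j + k) ≤ Submodule.span ℂ
    {x | ∃ (v : V) (μ : E.Path k v), ∃ y ∈ E.Dk j, x = μ.S * y * star μ.S} := by
  induction k with
  | zero =>
    intro x hx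
    rw [← mul_one x, E.one_eq, Finset.mul_sum]
    refine Submodule.sum_mem _ fun v _ => Submodule.subset_span ⟨v, .nil v, x, hx, ?_⟩
    rw [Path.S, E.star_P, mul_assoc, mul_comm_of_mem_Dk hE (Dk_mono hE (Nat.zero_le _)
      (P_mem_Dk_zero v)) (mul_mem_Dk hE hx (Dk_mono hE (Nat.zero_le _) (P_mem_Dk_zero v))),
      mul_assoc, E.P_mul_self]
  | succ k ih =>
    intro x hx
    rw [eq_sum_conj_S hE (k := j + k) hx]
    refine Submodule.sum_mem _ fun e _ => ?_
    have h1 := ih (star_S_mul_mul_S_mem_Dk e e hx)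
    revert h1
    generalize star (E.S e) * x * E.S e = z
    intro hz
    induction hz using Submodule.span_induction with
    | mem z hz =>
      obtain ⟨v, μ, y, hy, rfl⟩ := hz
      by_cases hv : v = E.r e
      · subst hv
        refine Submodule.subset_span ⟨_, .cons e rfl μ, y, hy, ?_⟩
        simp only [Path.S, star_mul, mul_assoc]
      · simp only [← mul_assoc]
        rw [S_mul_Path_S_of_ne hv]
        simp
    | zero => simp
    | add x y _ _ hx hy => simpa only [mul_add, add_mul] using add_mem hx hy
    | smul c x _ hx =>
      simpa only [mul_smul_comm, smul_mul_assoc] using Submodule.smul_mem _ c hx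

/-- An element of `F_E^k` that normalizes `D_E^k` also normalizes `D_E^m` for all `m ≥ k`. -/
theorem conj_mem_Dk_of_le (hE : E.NoSinks) {k m : ℕ} (hkm : k ≤ m) {w : E.CStar}
    (hw : w ∈ E.Fk k) (hn : ∀ x ∈ E.Dk k, w * x * star w ∈ E.Dk k) {x : E.CStar}
    (hx : x ∈ E.Dk m) : w * x * star w ∈ E.Dk m := by
  obtain ⟨j, rfl⟩ := Nat.exists_eq_add_of_le' hkm
  have h1 := Dk_add_le_span hE j k hx
  clear hx
  induction h1 using Submodule.span_induction with
  | mem x hx =>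
    obtain ⟨v, μ, y, hy, rfl⟩ := hx
    have key : ∀ (v₁ v₂ : V) (α : E.Path k v₁) (β : E.Path k v₂),
        ∃ z ∈ E.Dk j, star α.S * (w * (μ.S * y * star μ.S) * star w) * β.S =
          star α.S * (w * (μ.S * star μ.S) * star w) * β.S * z := by
      intro v₁ v₂ α β
      -- This coefficient of `w^*` lies in `D^0`, so `y` moves past it to the far right and leaves a
      -- coefficient of `w P_μ w^* ∈ D^k`, which vanishes off the diagonal.
      have hb := star_Path_S_mul_mul_Path_S_mem_of_mem_Fk hE μ β (star_mem_Fk hw)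
      refine ⟨y, hy, ?_⟩
      have h2 := mul_comm_of_mem_Dk hE hy (Dk_mono hE (Nat.zero_le _) hb)
      calc _ = star α.S * w * μ.S * (y * (star μ.S * star w * β.S)) := by simp only [mul_assoc]
        _ = _ := by rw [h2]; simp only [mul_assoc]
    have hc := hn _ (Submodule.subset_span ⟨v, μ, rfl⟩)
    refine mem_Dk_add_of_coeff hE j k (fun v₁ α => ?_) fun v₁ v₂ α β hne => ?_
    · obtain ⟨z, hz, h⟩ := key _ _ α α
      rw [h]
      refine mul_mem_Dk hE (Dk_mono hE (Nat.zero_le _) ?_) hz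
      have := mul_mem_Dk hE (star_Path_S_mul_mul_Path_S_mem_of_mem_Fk hE α μ hw)
        (star_Path_S_mul_mul_Path_S_mem_of_mem_Fk hE μ α (star_mem_Fk hw))
      simpa only [mul_assoc] using this
    · obtain ⟨z, hz, h⟩ := key _ _ α β
      rw [h, star_Path_S_mul_mul_Path_S_of_ne α β hne hc, zero_mul]
  | zero => simp
  | add x y _ _ hx hy => simpa only [mul_add, add_mul] using add_mem hx hy
  | smul c x _ hx =>
    simpa only [mul_smul_comm, smul_mul_assoc] using Submodule.smul_mem _ c hx

theorem conj_mem_Dk_of_mem_normalizer (hE : E.NoSinks) {k m : ℕ} (hkm : k ≤ m) {u : E.CStar}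
    (hN : u ∈ E.normalizer (E.Fk k) (E.Dk k)) {x : E.CStar} (hx : x ∈ E.Dk m) :
    u * x * star u ∈ E.Dk m :=
  conj_mem_Dk_of_le hE hkm hN.1 (fun x hx => by
    have h : u * x * star u ∈ (fun x => u * x * star u) '' (E.Dk k : Set E.CStar) := ⟨x, hx, rfl⟩
    rw [hN.2.2] at h
    exact h) hx

theorem star_conj_mem_Dk_of_mem_normalizer (hE : E.NoSinks) {k m : ℕ} (hkm : k ≤ m)
    {u : E.CStar} (hN : u ∈ E.normalizer (E.Fk k) (E.Dk k)) {x : E.CStar} (hx : x ∈ E.Dk m) :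
    star u * x * u ∈ E.Dk m := by
  have := conj_mem_Dk_of_le hE hkm (star_mem_Fk hN.1)
    (fun x hx => by rw [star_star]; exact conj_star_mem_Dk hN hx) hx
  rwa [star_star] at this

/-! ### The endomorphism `λ_u` on the diagonal -/

/-- The shift `φ(a) = ∑ S_e a S_e^*` is unital, and `φ(a) φ(b) = φ(ab)` when `a` commutes with the
projections `S_e^* S_e = P_{r(e)}`. -/
theorem shift_mem_UE (hE : E.NoSinks) {w : E.CStar} (hw : w ∈ E.UE) :
    ∑ e, E.S e * w * star (E.S e) ∈ E.UE := by
  have hmul : ∀ a b : E.CStar, (∀ v, a * E.P v = E.P v * a) → a * b = 1 →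
      (∑ e, E.S e * a * star (E.S e)) * ∑ e, E.S e * b * star (E.S e) = 1 := by
    intro a b ha hab
    rw [Finset.sum_mul, ← sum_S_mul_star_S hE]
    refine Finset.sum_congr rfl fun e _ => ?_
    rw [Finset.mul_sum, Finset.sum_eq_single e]
    · rw [conj_S_mul_conj_S, E.isCKFamily_PS.star_mul_self, ha, mul_assoc,
        mul_assoc (E.P _) a, hab, mul_one, ← mul_assoc, E.S_mul_P]
    · intro f _ hf
      rw [conj_S_mul_conj_S, E.isCKFamily_PS.star_mul_of_ne e f hf.symm]
      simp
    · simp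
  have hstar : star (∑ e, E.S e * w * star (E.S e)) = ∑ e, E.S e * star w * star (E.S e) := by
    rw [star_sum]
    exact Finset.sum_congr rfl fun e _ => by simp only [star_mul, star_star, mul_assoc]
  have hw' : ∀ v, star w * E.P v = E.P v * star w := fun v => by
    rw [← E.star_P, ← star_mul, ← star_mul, hw.2]
  refine ⟨Unitary.mem_iff.2 ⟨?_, ?_⟩, fun v => ?_⟩
  · rw [hstar]
    exact hmul _ _ hw' (Unitary.star_mul_self_of_mem hw.1)
  · rw [hstar]
    exact hmul _ _ hw.2 (Unitary.mul_star_self_of_mem hw.1)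
  · rw [Finset.sum_mul, Finset.mul_sum]
    refine Finset.sum_congr rfl fun e _ => ?_
    by_cases h : v = E.s e
    · subst h
      have h1 : star (E.S e) * E.P (E.s e) = star (E.S e) := by
        rw [← E.star_P, ← star_mul, E.P_mul_S]
      rw [mul_assoc, h1, ← mul_assoc, ← mul_assoc, E.P_mul_S]
    · have h1 : star (E.S e) * E.P v = 0 := by
        rw [← E.star_P, ← star_mul, E.P_mul_S_of_ne h, star_zero]
      rw [mul_assoc, h1, ← mul_assoc, ← mul_assoc, E.P_mul_S_of_ne h]
      simp

variable {u : E.CStar}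

/-- With the shift `φ`, the unitaries are `w_0 = 1` and `w_{r+1} = u φ(w_r)`, that is `w_r = u φ(u)
⋯ φ^{r-1}(u)`. -/
theorem exists_lam_eq_conj (hE : E.NoSinks) (hu : u ∈ E.UE) (r : ℕ) :
    ∃ w ∈ E.UE, ∀ x ∈ E.Dk r, lam hu x = w * x * star w := by
  induction r with
  | zero =>
    refine ⟨1, ⟨one_mem _, fun v => by rw [one_mul, mul_one]⟩, fun x hx => ?_⟩
    rw [star_one, mul_one, one_mul, lam_eq_self_of_mem_Dk_zero hu hx]
  | succ r ih =>
    obtain ⟨w, hw, h⟩ := ih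
    have hs := shift_mem_UE hE hw
    refine ⟨u * ∑ e, E.S e * w * star (E.S e), ⟨mul_mem hu.1 hs.1, fun v => ?_⟩, fun x hx => ?_⟩
    · rw [mul_assoc, hs.2, ← mul_assoc, hu.2, mul_assoc]
    · have hS : ∀ f, (∑ e, E.S e * w * star (E.S e)) * E.S f = E.S f * w := by
        intro f
        rw [Finset.sum_mul, Finset.sum_eq_single f]
        · rw [mul_assoc, E.isCKFamily_PS.star_mul_self, mul_assoc, hw.2, ← mul_assoc, E.S_mul_P]
        · intro e _ he
          rw [mul_assoc, E.isCKFamily_PS.star_mul_of_ne e f he, mul_zero]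
        · simp
      conv_lhs => rw [eq_sum_conj_S hE hx]
      conv_rhs => rw [eq_sum_conj_S hE hx]
      rw [map_sum, Finset.mul_sum, Finset.sum_mul]
      refine Finset.sum_congr rfl fun e _ => ?_
      rw [lam_conj_S, h _ (star_S_mul_mul_S_mem_Dk e e hx)]
      generalize star (E.S e) * x * E.S e = y
      have hS' := congrArg star (hS e)
      rw [star_mul, star_mul] at hS'
      rw [star_mul]
      calc _ = u * ((E.S e * w) * y * (star w * star (E.S e))) * star u := by
            simp only [mul_assoc]
        _ = _ := by rw [← hS', ← hS]; simp only [mul_assoc]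

/-- Unitary conjugation is isometric on each `D^r`; continuity extends this to the closure of their
union. -/
theorem norm_lam (hE : E.NoSinks) (hu : u ∈ E.UE) {x : E.CStar} (hx : x ∈ E.diagonal) :
    ‖lam hu x‖ = ‖x‖ := by
  rw [← SetLike.mem_coe, coe_diagonal hE] at hx
  have hc : IsClosed {x : E.CStar | ‖lam hu x‖ = ‖x‖} :=
    isClosed_eq (continuous_lam hu).norm continuous_norm
  refine closure_minimal (fun y hy => ?_) hc hx
  obtain ⟨r, hr⟩ := Set.mem_iUnion.1 hy
  obtain ⟨w, hw, h⟩ := exists_lam_eq_conj hE hu r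
  change ‖lam hu y‖ = ‖y‖
  rw [h y hr, CStarRing.norm_mul_mem_unitary _ (Unitary.star_mem hw.1),
    CStarRing.norm_mem_unitary_mul _ hw.1]

theorem isClosed_lam_image_diagonal (hE : E.NoSinks) (hu : u ∈ E.UE) :
    IsClosed (lam hu '' (E.diagonal : Set E.CStar)) := by
  have : CompleteSpace E.diagonal := isClosed_diagonal.completeSpace_coe
  have hi : Isometry fun x : E.diagonal => lam hu x := by
    refine Isometry.of_dist_eq fun x y => ?_
    rw [dist_eq_norm, ← map_sub, norm_lam hE hu (sub_mem x.2 y.2), ← dist_eq_norm]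
    rfl
  have := hi.isClosedEmbedding.isClosed_range
  rwa [show Set.range (fun x : E.diagonal => lam hu x) = lam hu '' (E.diagonal : Set E.CStar) by
    ext; simp] at this

theorem injOn_lam_diagonal (hE : E.NoSinks) (hu : u ∈ E.UE) :
    Set.InjOn (lam hu) (E.diagonal : Set E.CStar) := by
  intro x hx y hy h
  have h1 := norm_lam hE hu (sub_mem hx hy)
  rw [map_sub, sub_eq_zero.2 h, norm_zero] at h1
  exact sub_eq_zero.1 (norm_eq_zero.1 h1.symm)

/-- Use `λ_u(S_e y S_e^*) = u S_e λ_u(y) S_e^* u^*`. The offset `k` keeps every level high enough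
for `u` to normalize it. -/
theorem lam_mem_Dk_add (hE : E.NoSinks) (hu : u ∈ E.UE) {k : ℕ}
    (hN : u ∈ E.normalizer (E.Fk k) (E.Dk k)) (r : ℕ) {x : E.CStar} (hx : x ∈ E.Dk r) :
    lam hu x ∈ E.Dk (k + r) := by
  induction r generalizing x with
  | zero =>
    rw [lam_eq_self_of_mem_Dk_zero hu hx]
    exact Dk_mono hE (Nat.zero_le _) hx
  | succ r ih =>
    rw [eq_sum_conj_S hE hx, map_sum]
    refine Submodule.sum_mem _ fun e _ => ?_
    rw [lam_conj_S]
    exact conj_mem_Dk_of_mem_normalizer hE (Nat.le_add_right _ _) hN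
      (conj_S_mem_Dk (k := k + r) e (ih (star_S_mul_mul_S_mem_Dk e e hx)))

theorem mapsTo_lam_diagonal (hE : E.NoSinks) (hu : u ∈ E.UE) {k : ℕ}
    (hN : u ∈ E.normalizer (E.Fk k) (E.Dk k)) :
    Set.MapsTo (lam hu) (E.diagonal : Set E.CStar) (E.diagonal : Set E.CStar) := by
  intro x hx
  rw [coe_diagonal hE] at hx ⊢
  refine map_mem_closure (continuous_lam hu) hx fun y hy => ?_
  obtain ⟨r, hr⟩ := Set.mem_iUnion.1 hy
  exact Set.mem_iUnion.2 ⟨k + r, lam_mem_Dk_add hE hu hN r hr⟩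

end FiniteEdges

end DirectedGraph

namespace DirectedGraph

variable {V : Type u} {Ed : Type v} {E : DirectedGraph V Ed} [Fintype V]

/-! ### The subspaces `Ξ_r^D` -/

section XiD

variable {u : E.CStar}

/-- By sesquilinearity the generators of `H` suffice, and `λ_u(S_e) = u S_e`. -/
theorem XiD_succ (hu : u ∈ E.UE) (k r : ℕ) : XiD hu k (r + 1) =
    Submodule.span ℂ {y | ∃ e f, ∃ x ∈ XiD hu k r, y = aMap u e f x} := by
  have haux : ∀ e f x, star (lam hu (E.S e)) * x * lam hu (E.S f) = aMap u e f x := by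
    intro e f x
    rw [aMap_apply, lam_S, lam_S, star_mul]
    simp only [mul_assoc]
  refine le_antisymm (Submodule.span_le.2 ?_) (Submodule.span_le.2 ?_)
  · rintro _ ⟨g, hg, x, hx, h, hh, rfl⟩
    rw [SetLike.mem_coe]
    induction hg using Submodule.span_induction with
    | mem g hg =>
      obtain ⟨e, rfl⟩ := hg
      induction hh using Submodule.span_induction with
      | mem h hh =>
        obtain ⟨f, rfl⟩ := hh
        exact Submodule.subset_span ⟨e, f, x, hx, haux e f x⟩
      | zero => simp
      | add a b _ _ ha hb => rw [map_add, mul_add]; exact add_mem ha hb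
      | smul c a _ ha => rw [map_smul, mul_smul_comm]; exact Submodule.smul_mem _ _ ha
    | zero => simp
    | add a b _ _ ha hb => rw [map_add, star_add, add_mul, add_mul]; exact add_mem ha hb
    | smul c a _ ha =>
      rw [map_smul, star_smul, smul_mul_assoc, smul_mul_assoc]
      exact Submodule.smul_mem _ _ ha
  · rintro _ ⟨e, f, x, hx, rfl⟩
    exact Submodule.subset_span ⟨_, Submodule.subset_span ⟨e, rfl⟩, x, hx, _,
      Submodule.subset_span ⟨f, rfl⟩, (haux e f x).symm⟩

theorem aMap_mem_XiD_succ (hu : u ∈ E.UE) {k r : ℕ} (e f : Ed) {x : E.CStar}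
    (hx : x ∈ XiD hu k r) : aMap u e f x ∈ XiD hu k (r + 1) := by
  rw [XiD_succ]
  exact Submodule.subset_span ⟨e, f, x, hx, rfl⟩

/-- The image of `Ξ_r^D` in `V_k^D`. -/
noncomputable def XiQuot (hu : u ∈ E.UE) (k r : ℕ) : Submodule ℂ (E.VD k) :=
  ((XiD hu k r).submoduleOf (E.Dk (k - 1))).map (Submodule.mkQ _)

theorem XiQuot_zero (hu : u ∈ E.UE) (k : ℕ) : XiQuot hu k 0 = ⊤ := by
  have h : (XiD hu k 0).submoduleOf (E.Dk (k - 1)) = ⊤ := Submodule.submoduleOf_self _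
  rw [XiQuot, h, Submodule.map_top, Submodule.range_mkQ]

variable [Fintype Ed] {k : ℕ}

theorem antitone_XiD (hE : E.NoSinks) (hk : 1 ≤ k) (hu : u ∈ E.UE)
    (hN : u ∈ E.normalizer (E.Fk k) (E.Dk k)) : Antitone (XiD hu k) := by
  refine antitone_nat_of_succ_le fun r => ?_
  induction r with
  | zero =>
    rw [XiD_succ, Submodule.span_le]
    rintro _ ⟨e, f, x, hx, rfl⟩
    exact aMap_mem_Dk hE hk hN e f x hx
  | succ r ih =>
    rw [XiD_succ _ _ (r + 1), Submodule.span_le]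
    rintro _ ⟨e, f, x, hx, rfl⟩
    exact aMap_mem_XiD_succ hu e f (ih hx)

theorem aMap_eq_zero_of_ne (hE : E.NoSinks) (hk : 1 ≤ k)
    (hN : u ∈ E.normalizer (E.Fk k) (E.Dk k)) {e f : Ed} (hef : e ≠ f) {x : E.CStar}
    (hx : x ∈ E.Dk (k - 1)) : aMap u e f x = 0 := by
  obtain ⟨n, rfl⟩ := Nat.exists_eq_add_of_le' hk
  rw [Nat.add_sub_cancel] at hx
  rw [← star_S_mul_mul_S_of_ne hef (conj_star_mem_Dk hN (Dk_le_succ hE n hx)), aMap_apply]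
  simp only [mul_assoc]

/-- A decreasing sequence of subspaces of the finite-dimensional space `D^{k-1}` stabilizes, so the
intersection is one of its terms. -/
theorem XiDInf_le_iff (hE : E.NoSinks) (hk : 1 ≤ k) (hu : u ∈ E.UE)
    (hN : u ∈ E.normalizer (E.Fk k) (E.Dk k)) (W : Submodule ℂ E.CStar) :
    XiDInf hu k ≤ W ↔ ∃ r, XiD hu k r ≤ W := by
  refine ⟨fun h => ?_, fun ⟨r, hr⟩ => (iInf_le _ r).trans hr⟩
  have hanti := antitone_XiD hE hk hu hN
  have := finiteDimensional_Dk hE (k - 1)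
  let F : ℕ →o (Submodule ℂ (E.Dk (k - 1)))ᵒᵈ :=
    ⟨fun r => OrderDual.toDual ((XiD hu k r).submoduleOf (E.Dk (k - 1))),
      fun r s hrs => Submodule.comap_mono (hanti hrs)⟩
  obtain ⟨n, hn⟩ := IsArtinian.monotone_stabilizes F
  refine ⟨n, fun x hx => h ?_⟩
  have hx0 : x ∈ E.Dk (k - 1) := hanti (Nat.zero_le n) hx
  rw [XiDInf, Submodule.mem_iInf]
  intro m
  rcases le_total n m with hnm | hmn
  · have h1 : (⟨x, hx0⟩ : E.Dk (k - 1)) ∈ (XiD hu k n).submoduleOf (E.Dk (k - 1)) := hx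
    have h2 : (XiD hu k n).submoduleOf (E.Dk (k - 1)) =
      (XiD hu k m).submoduleOf (E.Dk (k - 1)) := hn m hnm
    rw [h2] at h1
    exact h1
  · exact hanti hmn hx

/-! ### Nilpotency of `A_u^D` -/

theorem XiD_le_Dk_zero_iff (hE : E.NoSinks) (hk : 1 ≤ k) (hu : u ∈ E.UE)
    (hN : u ∈ E.normalizer (E.Fk k) (E.Dk k)) (r : ℕ) :
    XiD hu k r ≤ E.Dk 0 ↔ XiQuot hu k r = ⊥ := by
  rw [XiQuot, ← le_bot_iff, Submodule.map_le_iff_le_comap, Submodule.comap_bot,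
    Submodule.ker_mkQ]
  exact ⟨fun h x hx => h hx, fun h x hx =>
    @h ⟨x, antitone_XiD hE hk hu hN (Nat.zero_le r) hx⟩ hx⟩

theorem XiQuot_succ (hE : E.NoSinks) (hk : 1 ≤ k) (hu : u ∈ E.UE)
    (hN : u ∈ E.normalizer (E.Fk k) (E.Dk k)) (r : ℕ) :
    XiQuot hu k (r + 1) = ⨆ e, ⨆ f, (XiQuot hu k r).map (bTilde hE hk hu hN e f) := by
  have hanti := antitone_XiD hE hk hu hN
  refine le_antisymm ?_ (iSup_le fun e => iSup_le fun f => ?_)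
  · rintro _ ⟨⟨x, hx0⟩, hx, rfl⟩
    replace hx : x ∈ XiD hu k (r + 1) := hx
    rw [XiD_succ] at hx
    have h1 : XiD hu k (r + 1) ≤ E.Dk (k - 1) := hanti (Nat.zero_le _)
    -- Membership in `D^{k-1}` is made part of the claim so that span induction applies to the bare
    -- element `x`.
    have key : ∃ hx0 : x ∈ E.Dk (k - 1), Submodule.Quotient.mk ⟨x, hx0⟩ ∈
        ⨆ e, ⨆ f, (XiQuot hu k r).map (bTilde hE hk hu hN e f) := by
      clear hx0
      induction hx using Submodule.span_induction with
      | mem x hx =>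
        obtain ⟨e, f, y, hy, rfl⟩ := hx
        have hy0 : y ∈ E.Dk (k - 1) := hanti (Nat.zero_le _) hy
        refine ⟨h1 (aMap_mem_XiD_succ hu e f hy), Submodule.mem_iSup_of_mem e
          (Submodule.mem_iSup_of_mem f ⟨Submodule.mkQ _ ⟨y, hy0⟩, ⟨⟨y, hy0⟩, hy, rfl⟩, rfl⟩)⟩
      | zero => exact ⟨zero_mem _, zero_mem _⟩
      | add a b _ _ ha hb =>
        obtain ⟨ha0, ha⟩ := ha
        obtain ⟨hb0, hb⟩ := hb
        exact ⟨add_mem ha0 hb0, add_mem ha hb⟩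
      | smul c a _ ha =>
        obtain ⟨ha0, ha⟩ := ha
        exact ⟨Submodule.smul_mem _ c ha0, Submodule.smul_mem _ c ha⟩
    exact key.2
  · rintro _ ⟨_, ⟨⟨x, hx0⟩, hx, rfl⟩, rfl⟩
    exact ⟨⟨_, aMap_mem_Dk hE hk hN e f x hx0⟩, aMap_mem_XiD_succ hu e f hx, rfl⟩

theorem map_XiQuot_le (hE : E.NoSinks) (hk : 1 ≤ k) (hu : u ∈ E.UE)
    (hN : u ∈ E.normalizer (E.Fk k) (E.Dk k)) {a : Module.End ℂ (E.VD k)}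
    (ha : a ∈ AD hE hk hu hN) (r : ℕ) : (XiQuot hu k r).map a ≤ XiQuot hu k (r + 1) := by
  have hanti : ∀ r, XiQuot hu k (r + 1) ≤ XiQuot hu k r := fun r =>
    Submodule.map_mono (Submodule.comap_mono (antitone_XiD hE hk hu hN (Nat.le_succ r)))
  rw [Submodule.map_le_iff_le_comap]
  induction ha using NonUnitalSubring.closure_induction generalizing r with
  | mem b hb =>
    obtain ⟨e, f, rfl⟩ := hb
    rw [← Submodule.map_le_iff_le_comap, XiQuot_succ hE hk hu hN]
    exact le_iSup₂_of_le e f le_rfl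
  | zero => exact fun x _ => Submodule.mem_comap.2 (zero_mem _)
  | add a b _ _ ha hb => exact fun x hx => Submodule.mem_comap.2 (add_mem (ha r hx) (hb r hx))
  | neg a _ ha => exact fun x hx => Submodule.mem_comap.2 (neg_mem (ha r hx))
  -- A product advances two steps; monotonicity gives one of them back.
  | mul a b _ _ ha hb => exact fun x hx => hanti _ (ha (r + 1) (hb r hx))

/-- Products of `l` ring elements send the whole quotient into the image of `Ξ_l`, and that image is
spanned by the ranges of products of `l` generators. -/
theorem isNilpotentRing_AD_iff (hE : E.NoSinks) (hk : 1 ≤ k) (hu : u ∈ E.UE)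
    (hN : u ∈ E.normalizer (E.Fk k) (E.Dk k)) :
    (AD hE hk hu hN).IsNilpotentRing ↔ ∃ r, XiD hu k r ≤ E.Dk 0 := by
  constructor
  · rintro ⟨l, -, hl⟩
    refine ⟨l, (XiD_le_Dk_zero_iff hE hk hu hN l).2 (le_bot_iff.1 ?_)⟩
    have key : ∀ r, XiQuot hu k r ≤ ⨆ L : {L : List (Module.End ℂ (E.VD k)) //
        L.length = r ∧ ∀ a ∈ L, a ∈ AD hE hk hu hN}, LinearMap.range L.1.prod := by
      intro r
      induction r with
      | zero =>
        refine le_iSup_of_le ⟨[], rfl, by simp⟩ ?_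
        rw [List.prod_nil, Module.End.one_eq_id, LinearMap.range_id]
        exact le_top
      | succ r ih =>
        rw [XiQuot_succ hE hk hu hN]
        refine iSup_le fun e => iSup_le fun f => (Submodule.map_mono ih).trans ?_
        rw [Submodule.map_iSup]
        refine iSup_le fun L => ?_
        refine le_iSup_of_le ⟨bTilde hE hk hu hN e f :: L.1, by simp [L.2.1], ?_⟩ ?_
        · intro a ha
          rcases List.mem_cons.1 ha with rfl | ha
          · exact NonUnitalSubring.subset_closure ⟨e, f, rfl⟩
          · exact L.2.2 a ha
        · rw [List.prod_cons, Module.End.mul_eq_comp, LinearMap.range_comp]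
    refine (key l).trans (iSup_le fun L => ?_)
    rw [hl L.1 L.2.1 L.2.2, LinearMap.range_zero]
  · rintro ⟨r, hr⟩
    -- The exponent is `r + 1` because `r` may be `0`, while nilpotency asks for a positive length.
    refine ⟨r + 1, Nat.le_add_left _ _, fun L hL hLA => ?_⟩
    have key : ∀ L : List (Module.End ℂ (E.VD k)), (∀ a ∈ L, a ∈ AD hE hk hu hN) →
        LinearMap.range L.prod ≤ XiQuot hu k L.length := by
      intro L hL
      induction L with
      | nil => rw [List.length_nil, XiQuot_zero]; exact le_top
      | cons a L ih =>
        rw [List.prod_cons, Module.End.mul_eq_comp, LinearMap.range_comp, List.length_cons]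
        exact (Submodule.map_mono (ih fun b hb => hL b (List.mem_cons_of_mem _ hb))).trans
          (map_XiQuot_le hE hk hu hN (hL a List.mem_cons_self) _)
    have h1 := key L hLA
    rw [hL, (XiD_le_Dk_zero_iff hE hk hu hN (r + 1)).1
      ((antitone_XiD hE hk hu hN (Nat.le_succ r)).trans hr), le_bot_iff] at h1
    exact LinearMap.range_eq_bot.1 h1

/-! ### Surjectivity of `λ_u` on the diagonal -/

/-- Decompose `u^* x u` into its blocks `a_{e,e}(x) = λ_u(z_e)` and conjugate back by `u`: the sum
is `λ_u(∑ S_e z_e S_e^*)`. -/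
theorem mem_lam_image_of_forall_aMap (hE : E.NoSinks) (hu : u ∈ E.UE) {m : ℕ} {x : E.CStar}
    (hx : star u * x * u ∈ E.Dk (m + 1))
    (h : ∀ e, aMap u e e x ∈ lam hu '' (E.diagonal : Set E.CStar)) :
    x ∈ lam hu '' (E.diagonal : Set E.CStar) := by
  choose z hz hzx using h
  refine ⟨∑ e, E.S e * z e * star (E.S e),
    sum_mem fun e _ => conj_S_mem_diagonal hE e (hz e), ?_⟩
  have h1 : x = u * (star u * x * u) * star u := by
    calc x = (u * star u) * x * (u * star u) := by
          rw [Unitary.mul_star_self_of_mem hu.1, one_mul, mul_one]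
      _ = _ := by simp only [mul_assoc]
  conv_rhs => rw [h1, eq_sum_conj_S hE hx, Finset.mul_sum, Finset.sum_mul]
  rw [map_sum]
  refine Finset.sum_congr rfl fun e _ => ?_
  rw [lam_conj_S, hzx, aMap_apply]
  simp only [mul_assoc]

theorem bijOn_lam_diagonal_of_XiD_le (hE : E.NoSinks) (hk : 1 ≤ k) (hu : u ∈ E.UE)
    (hN : u ∈ E.normalizer (E.Fk k) (E.Dk k)) {r : ℕ} (hr : XiD hu k r ≤ E.Dk 0) :
    Set.BijOn (lam hu) (E.diagonal : Set E.CStar) (E.diagonal : Set E.CStar) := by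
  refine ⟨mapsTo_lam_diagonal hE hu hN, injOn_lam_diagonal hE hu, ?_⟩
  have h0 : ∀ x ∈ E.Dk (k - 1), x ∈ lam hu '' (E.diagonal : Set E.CStar) := by
    -- Lifting runs backwards along `Ξ_s`: compressions of `Ξ_s` lie in `Ξ_{s+1}`, so preimages for
    -- the latter give preimages for the former.
    have hstep : ∀ s, (∀ x ∈ XiD hu k s, x ∈ lam hu '' (E.diagonal : Set E.CStar)) →
        ∀ x ∈ XiD hu k 0, x ∈ lam hu '' (E.diagonal : Set E.CStar) := by
      intro s
      induction s with
      | zero => exact id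
      | succ s ih =>
        intro h
        refine ih fun x hx => ?_
        have hx0 : x ∈ E.Dk (k - 1) := antitone_XiD hE hk hu hN (Nat.zero_le s) hx
        have hx1 := conj_star_mem_Dk hN (Dk_mono hE (Nat.sub_le k 1) hx0)
        rw [← Nat.sub_add_cancel hk] at hx1
        exact mem_lam_image_of_forall_aMap hE hu hx1 fun e => h _ (aMap_mem_XiD_succ hu e e hx)
    exact hstep r fun x hx =>
      ⟨x, Dk_subset_diagonal hE (hr hx), lam_eq_self_of_mem_Dk_zero hu (hr hx)⟩
  -- Above level `k - 1` each compression lowers the level by one, since `u` normalizes all levels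
  -- from `k` on.
  have hm : ∀ m, ∀ x ∈ E.Dk (k - 1 + m), x ∈ lam hu '' (E.diagonal : Set E.CStar) := by
    intro m
    induction m with
    | zero => exact h0
    | succ m ih =>
      intro x hx
      have hx1 := star_conj_mem_Dk_of_mem_normalizer hE
        (show k ≤ k - 1 + (m + 1) by omega) hN hx
      refine mem_lam_image_of_forall_aMap hE hu (m := k - 1 + m) hx1 fun e => ih _ ?_
      have := star_S_mul_mul_S_mem_Dk (k := k - 1 + m) e e hx1
      rw [aMap_apply]
      simpa only [mul_assoc] using this
  intro x hx
  rw [coe_diagonal hE] at hx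
  refine closure_minimal (fun y hy => ?_) (isClosed_lam_image_diagonal hE hu) hx
  obtain ⟨m, hy⟩ := Set.mem_iUnion.1 hy
  exact hm m y (Dk_mono hE (Nat.le_add_left _ _) hy)

end XiD

end DirectedGraph

/-! ### Projections close to the image of `λ_u` -/

/-- A scalar multiple of a nonzero projection is as large as the scalar. -/
theorem IsStarProjection.norm_smul_of_ne_zero {A : Type*} [NonUnitalCStarAlgebra A] {p : A}
    (hp : IsStarProjection p) (h : p ≠ 0) (c : ℂ) : ‖c • p‖ = ‖c‖ := by
  have h1 : ‖p‖ = ‖p‖ * ‖p‖ := by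
    have := CStarRing.norm_star_mul_self (x := p)
    rwa [hp.isSelfAdjoint.star_eq, hp.isIdempotentElem.eq] at this
  have h2 : ‖p‖ = 1 := by
    have h0 : ‖p‖ ≠ 0 := norm_ne_zero_iff.2 h
    exact mul_left_cancel₀ h0 (by rw [mul_one]; exact h1.symm)
  rw [norm_smul, h2, mul_one]

namespace DirectedGraph

variable {V : Type u} {Ed : Type v} {E : DirectedGraph V Ed} [Fintype V]

theorem isStarProjection_Path {m : ℕ} {v : V} (μ : E.Path m v) :
    IsStarProjection (μ.S * star μ.S) := by
  refine ⟨?_, by simp [IsSelfAdjoint]⟩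
  have h : μ.S * star μ.S * μ.S = μ.S := by
    induction μ with
    | nil v => rw [Path.S, E.star_P, E.P_mul_self, E.P_mul_self]
    | cons e h μ ih =>
      have h1 : Path.S (.cons e h μ) * star (Path.S (.cons e h μ)) * Path.S (.cons e h μ) =
          E.S e * (μ.S * (star μ.S * (star (E.S e) * E.S e)) * μ.S) := by
        simp only [Path.S, star_mul, mul_assoc]
      rw [h1, E.isCKFamily_PS.star_mul_self, μ.star_S_mul_P, ih, Path.S]
  rw [IsIdempotentElem, ← mul_assoc, h]

variable [Fintype Ed]

/-- A projection in `D_E^m` whose distance to an element of `D_E^0` is less than `1 / 2` belongs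
to `D_E^0`. -/
theorem mem_Dk_zero_of_isStarProjection (hE : E.NoSinks) {m : ℕ} {p d : E.CStar}
    (hp : p ∈ E.Dk m) (hpp : IsStarProjection p) (hd : d ∈ E.Dk 0) (h : ‖p - d‖ < 1 / 2) :
    p ∈ E.Dk 0 := by
  rw [← mul_one p, E.one_eq, Finset.mul_sum]
  refine Submodule.sum_mem _ fun v _ => ?_
  obtain ⟨c, hc, -⟩ := mul_P_of_mem_Dk_zero hd v
  have hPv := E.isCKFamily_PS.isStarProjection v
  have hq : IsStarProjection (p * E.P v) := hpp.mul hPv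
    (mul_comm_of_mem_Dk hE hp (Dk_mono hE (Nat.zero_le m) (P_mem_Dk_zero v)))
  have hqP : p * E.P v * E.P v = p * E.P v := by rw [mul_assoc, E.P_mul_self]
  have hlt : ‖p * E.P v - c • E.P v‖ < 1 / 2 := by
    rw [← hc, ← sub_mul]
    exact (norm_mul_le _ _).trans_lt (lt_of_le_of_lt
      (mul_le_of_le_one_right (norm_nonneg _) hPv.norm_le) h)
  generalize p * E.P v = q at *
  by_cases h0 : q = 0
  · rw [h0]
    exact zero_mem _
  by_cases h1 : E.P v - q = 0
  · rw [← sub_eq_zero.1 h1]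
    exact P_mem_Dk_zero v
  -- If `q` and `P_v - q` are both nonzero, compressing `q - c P_v` by each gives `|1 - c| < 1/2`
  -- and `|c| < 1/2`, which is impossible.
  exfalso
  have hr : IsStarProjection (E.P v - q) := hq.sub_of_mul_eq_left hPv hqP
  have e1 : q * (q - c • E.P v) = (1 - c) • q := by
    rw [mul_sub, mul_smul_comm, hqP, hq.isIdempotentElem.eq, sub_smul, one_smul]
  have hPq : E.P v * q = q := by
    have := congrArg star hqP
    rwa [star_mul, E.star_P, hq.isSelfAdjoint.star_eq] at this
  have e2 : (E.P v - q) * (q - c • E.P v) = (-c) • (E.P v - q) := by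
    rw [mul_sub, sub_mul, hPq, hq.isIdempotentElem.eq, mul_smul_comm, sub_mul, E.P_mul_self, hqP,
      sub_self, zero_sub, neg_smul]
  have n1 : ‖1 - c‖ < 1 / 2 := by
    rw [← hq.norm_smul_of_ne_zero h0, ← e1]
    exact (norm_mul_le _ _).trans_lt (lt_of_le_of_lt
      (mul_le_of_le_one_left (norm_nonneg _) hq.norm_le) hlt)
  have n2 : ‖-c‖ < 1 / 2 := by
    rw [← hr.norm_smul_of_ne_zero h1, ← e2]
    exact (norm_mul_le _ _).trans_lt (lt_of_le_of_lt
      (mul_le_of_le_one_left (norm_nonneg _) hr.norm_le) hlt)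
  have n3 : ‖(1 : ℂ)‖ ≤ ‖1 - c‖ + ‖c‖ := by
    simpa using norm_add_le (1 - c) c
  rw [norm_one] at n3
  rw [norm_neg] at n2
  linarith

variable {u : E.CStar} {k : ℕ}

/-- The projections of `D_E^m` at distance less than `1 / 2` from `λ_u(D_E^n)`. -/
def nearProjections (hu : u ∈ E.UE) (m n : ℕ) : Set E.CStar :=
  {p | p ∈ E.Dk m ∧ IsStarProjection p ∧ ∃ y ∈ E.Dk n, ‖p - lam hu y‖ < 1 / 2}

/-- Since `a_{e,e}(λ_u(y)) = λ_u(S_e^* y S_e)` and `u S_e` is a contraction, the distance does not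
grow while the level of `y` drops by one. -/
theorem aMap_mem_nearProjections (hE : E.NoSinks) (hk : 1 ≤ k) (hu : u ∈ E.UE)
    (hN : u ∈ E.normalizer (E.Fk k) (E.Dk k)) {n : ℕ} {p : E.CStar}
    (hp : p ∈ nearProjections hu (k - 1) (n + 1)) (e : Ed) :
    aMap u e e p ∈ nearProjections hu (k - 1) n := by
  obtain ⟨hp0, hpp, y, hy, hlt⟩ := hp
  have ht : star u * p * u ∈ E.Dk k := conj_star_mem_Dk hN (Dk_mono hE (Nat.sub_le k 1) hp0)
  have hq : aMap u e e p = star (E.S e) * (star u * p * u) * E.S e := by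
    rw [aMap_apply]
    simp only [mul_assoc]
  have hS : E.S e * star (E.S e) ∈ E.Dk k := by
    refine Dk_mono hE hk (Submodule.subset_span ⟨_, .cons e rfl (.nil _), ?_⟩)
    rw [Path.S, Path.S, E.S_mul_P]
  refine ⟨aMap_mem_Dk hE hk hN e e p hp0, ⟨?_, ?_⟩, star (E.S e) * y * E.S e,
    star_S_mul_mul_S_mem_Dk e e hy, lt_of_le_of_lt ?_ hlt⟩
  · have htt : star u * p * u * (star u * p * u) = star u * p * u := by
      calc _ = star u * p * (u * star u) * p * u := by simp only [mul_assoc]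
        _ = star u * (p * p) * u := by
          rw [Unitary.mul_star_self_of_mem hu.1, mul_one]
          simp only [mul_assoc]
        _ = _ := by rw [hpp.isIdempotentElem.eq]
    rw [hq, IsIdempotentElem]
    generalize star u * p * u = t at *
    -- The compression stays idempotent because `t = u^* p u` and `S_e S_e^*` both lie in the
    -- commutative algebra `D^k`.
    calc _ = star (E.S e) * t * (E.S e * star (E.S e) * t) * E.S e := by simp only [mul_assoc]
      _ = star (E.S e) * (t * t) * (E.S e * star (E.S e) * E.S e) := by
        rw [mul_comm_of_mem_Dk hE hS ht]
        simp only [mul_assoc]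
      _ = _ := by rw [htt, E.isCKFamily_PS.partialIsometry]
  · rw [aMap_apply, IsSelfAdjoint]
    simp only [star_mul, star_star, hpp.isSelfAdjoint.star_eq, mul_assoc]
  · have h1 : aMap u e e p - lam hu (star (E.S e) * y * E.S e) =
        star (u * E.S e) * (p - lam hu y) * (u * E.S e) := by
      rw [aMap_apply, map_mul, map_mul, map_star, lam_S, mul_sub, sub_mul, star_mul]
      simp only [mul_assoc]
    have h2 : ‖u * E.S e‖ ≤ 1 := (isCKFamily_twist hu).norm_S_le e
    rw [h1]
    refine (norm_mul_le _ _).trans (mul_le_of_le_one_right (norm_nonneg _) h2 |>.trans ?_)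
    refine (norm_mul_le _ _).trans (mul_le_of_le_one_left (norm_nonneg _) ?_)
    rwa [norm_star]

theorem exists_XiD_le_of_surjOn (hE : E.NoSinks) (hk : 1 ≤ k) (hu : u ∈ E.UE)
    (hN : u ∈ E.normalizer (E.Fk k) (E.Dk k))
    (hs : Set.SurjOn (lam hu) (E.diagonal : Set E.CStar) (E.diagonal : Set E.CStar)) :
    ∃ r, XiD hu k r ≤ E.Dk 0 := by
  have hmono : Monotone (nearProjections hu (k - 1)) := fun m n hmn p ⟨h1, h2, y, hy, h3⟩ =>
    ⟨h1, h2, y, Dk_mono hE hmn hy, h3⟩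
  have hex : ∀ (v : V) (μ : E.Path (k - 1) v),
      ∃ n, μ.S * star μ.S ∈ nearProjections hu (k - 1) n := by
    intro v μ
    have hμ : μ.S * star μ.S ∈ E.Dk (k - 1) := Submodule.subset_span ⟨v, μ, rfl⟩
    obtain ⟨x, hx, hxμ⟩ := hs (Dk_subset_diagonal hE hμ)
    obtain ⟨n, y, hy, hlt⟩ := exists_mem_Dk_norm_sub_lt hE hx (show (0 : ℝ) < 1 / 2 by norm_num)
    refine ⟨n, hμ, isStarProjection_Path μ, y, hy, ?_⟩
    rwa [← hxμ, ← map_sub, norm_lam hE hu (sub_mem hx (Dk_subset_diagonal hE hy))]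
  -- Finitely many `P_μ` span `D^{k-1}`, so a single level `N` serves all of them.
  have hN0 : ∃ N, E.Dk (k - 1) ≤ Submodule.span ℂ (nearProjections hu (k - 1) N) := by
    have hfg : (E.Dk (k - 1)).FG := by
      have := finiteDimensional_Dk hE (k - 1)
      exact Module.Finite.iff_fg.1 this
    obtain ⟨s, hs, hspan⟩ := Submodule.fg_span_iff_fg_span_finset_subset _ |>.1 hfg
    have : ∀ p : s, ∃ n, (p : E.CStar) ∈ nearProjections hu (k - 1) n := by
      rintro ⟨p, hp⟩
      obtain ⟨v, μ, rfl⟩ := hs hp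
      exact hex v μ
    choose n hn using this
    have hle : ∀ p, n p ≤ Finset.univ.sup n := fun p => Finset.le_sup (Finset.mem_univ p)
    refine ⟨Finset.univ.sup n, hspan.le.trans (Submodule.span_mono fun p hp => ?_)⟩
    exact hmono (hle ⟨p, hp⟩) (hn ⟨p, hp⟩)
  obtain ⟨N, hN0⟩ := hN0
  -- Each step of `Ξ` uses up one level of approximation, and the maps `a_{e,f}` with `e ≠ f`
  -- contribute nothing.
  have key : ∀ r n, r + n = N → XiD hu k r ≤ Submodule.span ℂ (nearProjections hu (k - 1) n) := by
    intro r
    induction r with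
    | zero =>
      intro n hn
      rw [zero_add] at hn
      subst hn
      exact hN0
    | succ r ih =>
      intro n hn
      rw [XiD_succ, Submodule.span_le]
      rintro _ ⟨e, f, x, hx, rfl⟩
      by_cases hef : e = f
      · subst hef
        have hx1 := ih (n + 1) (by omega) hx
        rw [SetLike.mem_coe]
        clear hx
        induction hx1 using Submodule.span_induction with
        | mem x hx => exact Submodule.subset_span (aMap_mem_nearProjections hE hk hu hN hx e)
        | zero => simp
        | add a b _ _ ha hb => rw [map_add]; exact add_mem ha hb
        | smul c a _ ha => rw [map_smul]; exact Submodule.smul_mem _ _ ha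
      · rw [aMap_eq_zero_of_ne hE hk hN hef (antitone_XiD hE hk hu hN (Nat.zero_le r) hx)]
        exact zero_mem _
  refine ⟨N, (key N 0 (add_zero N)).trans (Submodule.span_le.2 ?_)⟩
  rintro p ⟨hp, hpp, y, hy, hlt⟩
  rw [lam_eq_self_of_mem_Dk_zero hu hy] at hlt
  exact mem_Dk_zero_of_isStarProjection hE hp hpp hy hlt

end DirectedGraph

/-- Let `E` be a finite graph without sinks and let `u ∈ 𝒰_E` be a unitary that normalizes `D_E^k`
in `F_E^k`, for some `k ≥ 1`. The following are equivalent: `λ_u` restricts to an automorphism of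
`D_E`; the ring `A_u^D` is nilpotent; `Ξ_u^D ⊆ D_E^0`. -/
theorem theorem5p3 {V : Type u} {Ed : Type v} [Fintype V] [Fintype Ed] (E : DirectedGraph V Ed)
    (hE : E.NoSinks) (k : ℕ) (hk : 1 ≤ k) (u : E.CStar) (hu : u ∈ E.UE)
    (hN : u ∈ E.normalizer (E.Fk k) (E.Dk k)) :
    List.TFAE [
      Set.BijOn (DirectedGraph.lam hu) (E.diagonal : Set E.CStar) (E.diagonal : Set E.CStar),
      (DirectedGraph.AD hE hk hu hN).IsNilpotentRing,
      DirectedGraph.XiDInf hu k ≤ E.Dk 0] := by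
  tfae_have 1 → 3 := fun h => (DirectedGraph.XiDInf_le_iff hE hk hu hN _).2
    (DirectedGraph.exists_XiD_le_of_surjOn hE hk hu hN h.surjOn)
  tfae_have 3 → 1 := fun h => by
    obtain ⟨r, hr⟩ := (DirectedGraph.XiDInf_le_iff hE hk hu hN _).1 h
    exact DirectedGraph.bijOn_lam_diagonal_of_XiD_le hE hk hu hN hr
  tfae_have 2 ↔ 3 := by
    rw [DirectedGraph.isNilpotentRing_AD_iff, DirectedGraph.XiDInf_le_iff hE hk hu hN]
  tfae_finish
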